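/- Let $n,m\ge 1$ be integers and $T^n=\mathbb R^n/\mathbb Z^n$ with its Lebesgue measure of total mass $1$. For $f\in L^2(T^n)$ and $a\in\mathbb Z^n$ put $c_a(f)=\int_{T^n}f(x)e^{-2\pi i\langle a,x\rangle}\,dx$, $w_a=(1+\langle a,a\rangle)^m$, and let $\|f\|^2_{H^m}=\sum_{a\in\mathbb Z^n}w_a|c_a(f)|^2$, a norm of the Sobolev space $H^m(T^n)$. Consider either of the following two settings. (R) $B$ is the closed unit ball, for this norm, of the real-valued functions in $H^m(T^n)$; the indeterminates are $c_a$, $a\in\mathbb Z^n$, and the conjugate of $c_a$ is the indeterminate $\bar c_a=c_{-a}$. (C) $B$ is the closed unit ball, for this norm, of the complex-valued functions in $H^m(T^n)$; the indeterminates are $c_a$ and $\bar c_a$, $a\in\mathbb Z^n$, and the conjugate of $c_a$ is $\bar c_a$ (and vice versa). Let $\mathbb C[c]$ be the ring of complex polynomials in these indeterminates, and $p(f)$ the value of $p\in\mathbb C[c]$ at $c_a=c_a(f)$, $\bar c_a=\overline{c_a(f)}$. Let $q^*$ be obtained from $q$ by conjugating the coefficients and the indeterminates. Let $d(p)$ be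 the total degree of $p$, and $\delta(p)$ the maximum of $\max_i|a_i|$ over the frequencies $a$ of the indeterminates that occur in $p$ (zero if there are none). Put $\mathbb C[c]_{r,\rho}=\{q: d(q)\le r,\ \delta(q)\le\rho\}$, let $\Sigma_{r,\rho}$ be the set of finite sums $\sum_k q_k^*q_k$ with $q_k\in\mathbb C[c]_{r,\rho}$ (and $\Sigma_{-1,\rho}=\{0\}$), and let $$Q_{r,\rho}=\Big\{s_0+s_1\Big(1-\sum_{\max_i|a_i|\le\rho}w_a c_a\bar c_a\Big): s_0\in\Sigma_{r,\rho},\ s_1\in\Sigma_{r-1,\rho}\Big\},\qquad Q_{\infty,\rho}=\bigcup_{r\in\mathbb N}Q_{r,\rho}.$$ Let $E=\{(c_a(f))_{a}: f\in B\}\subset\ell_2(\mathbb Z^n)$, and let $\gamma$ be a locally finite Borel measure on $\ell_2(\mathbb Z^n)$ such that $\gamma(U\cap E)>0$ for every open $U$ that meets $E$. Let $p\in\mathbb C[c]$ take real values on $B$, and write $p=\sum_\alpha p_\alpha c^\alpha$, where $\alpha$ runs over the finite multisets of indeterminates. For a family $y=(y_\alpha)_\alpha$ of complex numbers let $\ell_y(\sum_\alpha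 g_\alpha c^\alpha)=\sum_\alpha g_\alpha y_\alpha$. For $r\in\mathbb N\cup\{\infty\}$ and $\rho\in\mathbb N$ define $$p^{\rm out}_{r,\rho}=\inf\{\operatorname{Re}\ell_y(p): y_\emptyset=1,\ \ell_y(g)\ge 0\ \text{for all } g\in Q_{r,\rho}\},$$ $$p^{\rm inn}_{r,\rho}=\inf\Big\{\operatorname{Re}\ell_y(p): y_\emptyset=1,\ y_\alpha=\int_E c^\alpha g(c)\,d\gamma(c)\ \text{for all }\alpha,\ \text{for some } g\in Q_{r,\rho}\Big\},$$ and $p^*=\inf_{f\in B}p(f)$. **Theorem.** The infimum $p^*$ is attained. Let $\rho=\delta(p)$. For all finite $r\ge d(p)$ the infima $p^{\rm out}_{r,\rho}$ and $p^{\rm inn}_{r,\rho}$ are attained. For all finite $r\ge r'\ge d(p)$, $$p^{\rm out}_{r',\rho}\le p^{\rm out}_{r,\rho}\le p^{\rm out}_{\infty,\rho}=p^*=p^{\rm inn}_{\infty,\rho}\le p^{\rm inn}_{r,\rho}\le p^{\rm inn}_{r',\rho},$$ and $p^{\rm out}_{r,\rho}\to p^*$, $p^{\rm inn}_{r,\rho}\to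 p^*$ as $r\to\infty$. -/

import Mathlib

open MeasureTheory Filter Topology

noncomputable section

namespace SobolevPOP

-- The unit circle carries the Haar measure of total mass one.
attribute [local instance] instMeasureSpaceUnitAddCircle

/-- Frequencies: the index set `ℤⁿ` of the Fourier coefficients. -/
abbrev Freq (n : ℕ) : Type := Fin n → ℤ

/-- The space `L²(Tⁿ)` of complex-valued functions on the unit torus. -/
abbrev TorusL2 (n : ℕ) : Type := Lp ℂ 2 (volume : Measure (UnitAddTorus (Fin n)))

/-- The sequence space `ℓ₂(ℤⁿ)`. -/
abbrev SeqSpace (n : ℕ) : Type := lp (fun _ : Freq n => ℂ) 2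

/-- The two kinds of optimization variables: real-valued functions `f : Tⁿ → ℝ`, or
complex-valued functions `f : Tⁿ → ℂ`. -/
inductive Scalars : Type
  | real
  | complex

/-! ### The Sobolev ball and the Fourier ellipsoid -/

/-- The weight `w_a = (1 + ⟨a, a⟩) ^ m`. -/
def weight {n : ℕ} (m : ℕ) (a : Freq n) : ℝ := (1 + ∑ i, (a i : ℝ) ^ 2) ^ m

/-- The squared norm of `H^m(Tⁿ)` in the Fourier basis, `∑ₐ wₐ |cₐ|²` with
`cₐ = ∫ f(x) exp(-2πi⟨a,x⟩) dx`. It is finite exactly when `f` belongs to `H^m(Tⁿ)`. -/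
def sobolevNormSq {n : ℕ} (m : ℕ) (f : TorusL2 n) : ENNReal :=
  ∑' a : Freq n, ENNReal.ofReal (weight m a * ‖UnitAddTorus.mFourierCoeff f a‖ ^ 2)

/-- The closed unit ball `B` of `H^m(Tⁿ)`, of real-valued or of complex-valued functions. -/
def ball (s : Scalars) (n m : ℕ) : Set (TorusL2 n) :=
  match s with
  | .real => {f | sobolevNormSq m f ≤ 1 ∧ ∀ᵐ x, (f x).im = 0}
  | .complex => {f | sobolevNormSq m f ≤ 1}

/-- The Fourier ellipsoid `E = F B`, where `F : L²(Tⁿ) → ℓ₂(ℤⁿ)` is the Fourier transform. -/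
def ellipsoid (s : Scalars) (n m : ℕ) : Set (SeqSpace n) :=
  (fun f : TorusL2 n => UnitAddTorus.mFourierBasis.repr f) '' ball s n m

/-! ### Polynomials in the Fourier coefficients -/

/-- The indeterminates. For real-valued functions there is one indeterminate `c_a` for each
frequency (the conjugate of `c_a` being `c_{-a}`). For complex-valued functions there are two for
each frequency, one for `c_a` and one for its conjugate. -/
inductive Letter : Scalars → ℕ → Type
  | re {n : ℕ} (a : Freq n) : Letter .real n
  | co {n : ℕ} (a : Freq n) : Letter .complex n
  | conjCo {n : ℕ} (a : Freq n) : Letter .complex n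

/-- The indeterminate `c_a`. -/
def coord (s : Scalars) {n : ℕ} (a : Freq n) : Letter s n :=
  match s with
  | .real => .re a
  | .complex => .co a

/-- The frequency of an indeterminate. -/
def freq {s : Scalars} {n : ℕ} (v : Letter s n) : Freq n :=
  match v with
  | .re a => a
  | .co a => a
  | .conjCo a => a

/-- The indeterminate that stands for the complex conjugate of a given one. -/
def conjLetter {s : Scalars} {n : ℕ} (v : Letter s n) : Letter s n :=
  match v with
  | .re a => .re (-a)
  | .co a => .conjCo a
  | .conjCo a => .co a

/-- The value of an indeterminate at a family `c` of Fourier coefficients. -/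
def letterValue {s : Scalars} {n : ℕ} (c : Freq n → ℂ) (v : Letter s n) : ℂ :=
  match v with
  | .re a => c a
  | .co a => c a
  | .conjCo a => (starRingEnd ℂ) (c a)

/-- The polynomial ring `ℂ[c]`. Its monomials are indexed by the finite families of
indeterminates, repetitions allowed, i.e. by `Letter s n →₀ ℕ`. -/
abbrev Poly (s : Scalars) (n : ℕ) : Type := MvPolynomial (Letter s n) ℂ

/-- The value `p(c)` at a sequence `c` of Fourier coefficients. -/
def evalSeq {s : Scalars} {n : ℕ} (p : Poly s n) (c : Freq n → ℂ) : ℂ :=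
  MvPolynomial.eval (letterValue c) p

/-- The value `p(f)` at a function `f`. -/
def evalFun {s : Scalars} {n : ℕ} (p : Poly s n) (f : TorusL2 n) : ℂ :=
  evalSeq p (UnitAddTorus.mFourierCoeff f)

/-- Hermitian polynomials: those with real values at all `f ∈ B`. -/
def IsHermitian {s : Scalars} {n : ℕ} (m : ℕ) (p : Poly s n) : Prop :=
  ∀ f ∈ ball s n m, (evalFun p f).im = 0

/-- The adjoint `q*`: coefficients are conjugated and so are the indeterminates. -/
def adjoint {s : Scalars} {n : ℕ} (q : Poly s n) : Poly s n :=
  MvPolynomial.rename conjLetter (MvPolynomial.map (starRingEnd ℂ) q)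

/-- The algebraic degree `d(p)`. -/
def algebraicDegree {s : Scalars} {n : ℕ} (p : Poly s n) : ℕ := p.totalDegree

/-- The harmonic degree `δ(p)`: the largest `|a_i|` over the frequencies `a` of the
indeterminates that occur in `p`. -/
def harmonicDegree {s : Scalars} {n : ℕ} (p : Poly s n) : ℕ :=
  p.vars.sup fun v => Finset.univ.sup fun i => (freq v i).natAbs

/-! ### Sums of squares and truncated quadratic modules -/

/-- The finite sums `∑ₖ qₖ* qₖ` with all `qₖ` in `S`. -/
def sumsOfSquares {s : Scalars} {n : ℕ} (S : Set (Poly s n)) : Set (Poly s n) :=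
  (AddSubmonoid.closure {g : Poly s n | ∃ q ∈ S, g = adjoint q * q} : Set (Poly s n))

/-- The polynomial `1 - ∑_{δₐ ≤ ρ} wₐ |cₐ|²`. -/
def ballPoly (s : Scalars) (n m ρ : ℕ) : Poly s n :=
  1 - ∑ a ∈ Finset.Icc (fun _ : Fin n => -(ρ : ℤ)) (fun _ : Fin n => (ρ : ℤ)),
    MvPolynomial.C (weight m a : ℂ) *
      (MvPolynomial.X (coord s a) * MvPolynomial.X (conjLetter (coord s a)))

/-- The truncated quadratic module `Q_{r,ρ}`. In the second sum of squares the degree bound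
`≤ r - 1` is written `< r`; for `r = 0` this leaves only `s₁ = 0`. -/
def quadModule (s : Scalars) (n m r ρ : ℕ) : Set (Poly s n) :=
  {g | ∃ s₀ ∈ sumsOfSquares {q : Poly s n | algebraicDegree q ≤ r ∧ harmonicDegree q ≤ ρ},
    ∃ s₁ ∈ sumsOfSquares {q : Poly s n | algebraicDegree q < r ∧ harmonicDegree q ≤ ρ},
      g = s₀ + s₁ * ballPoly s n m ρ}

/-- The quadratic module `Q_{∞,ρ} = ⋃ᵣ Q_{r,ρ}`. -/
def quadModuleTop (s : Scalars) (n m ρ : ℕ) : Set (Poly s n) :=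
  ⋃ r : ℕ, quadModule s n m r ρ

/-! ### Cones of moment sequences and the bounds -/

/-- Sequences indexed by the monomials. -/
abbrev MomentSeq (s : Scalars) (n : ℕ) : Type := (Letter s n →₀ ℕ) → ℂ

/-- The linear functional `ℓ_y : ∑ p_a c^a ↦ ∑ p_a y_a`. -/
def riesz {s : Scalars} {n : ℕ} (y : MomentSeq s n) (p : Poly s n) : ℂ :=
  ∑ α ∈ p.support, p.coeff α * y α

/-- The outer cone: all `y` with `ℓ_y ≥ 0` on `Q`. -/
def outerCone {s : Scalars} {n : ℕ} (Q : Set (Poly s n)) : Set (MomentSeq s n) :=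
  {y | ∀ g ∈ Q, 0 ≤ (riesz y g).re ∧ (riesz y g).im = 0}

/-- The inner cone: all moment sequences of the measures on `E` with a density from `Q` with
respect to `γ`. -/
def innerCone {s : Scalars} {n : ℕ} (m : ℕ) [MeasurableSpace (SeqSpace n)]
    (γ : Measure (SeqSpace n)) (Q : Set (Poly s n)) : Set (MomentSeq s n) :=
  {y | ∃ g ∈ Q, ∀ α, y α =
    ∫ c in ellipsoid s n m, evalSeq (MvPolynomial.monomial α 1) c * evalSeq g c ∂γ}

/-- The set of the normalized elements (`y_∅ = 1`) of a cone of moment sequences. -/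
def normalized {s : Scalars} {n : ℕ} (K : Set (MomentSeq s n)) : Set (MomentSeq s n) :=
  {y | y ∈ K ∧ y 0 = 1}

/-- The optimal value of the linear problem `inf ∑ p_a y_a` over the `y ∈ K` with `y_∅ = 1`.
Only the coordinates of `y` in `spt p ∪ {∅}` enter, so that this is also the optimal value over
the projection of `K` on these coordinates. -/
def linearBound {s : Scalars} {n : ℕ} (K : Set (MomentSeq s n)) (p : Poly s n) : EReal :=
  ⨅ y ∈ normalized K, ((riesz y p).re : EReal)

/-- The infimum in `linearBound` is attained. -/
def LinearBoundAttained {s : Scalars} {n : ℕ} (K : Set (MomentSeq s n)) (p : Poly s n) : Prop :=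
  ∃ y ∈ normalized K, ((riesz y p).re : EReal) = linearBound K p

/-- The optimal value `p* = inf_{f ∈ B} p(f)`. -/
def optimum {s : Scalars} {n : ℕ} (m : ℕ) (p : Poly s n) : EReal :=
  ⨅ f ∈ ball s n m, ((evalFun p f).re : EReal)

/-- The lower bound `p^out_{r,ρ}`. -/
def outBound {s : Scalars} {n : ℕ} (m r ρ : ℕ) (p : Poly s n) : EReal :=
  linearBound (outerCone (quadModule s n m r ρ)) p

/-- The limit bound `p^out_{∞,ρ}`. -/
def outBoundTop {s : Scalars} {n : ℕ} (m ρ : ℕ) (p : Poly s n) : EReal :=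
  linearBound (outerCone (quadModuleTop s n m ρ)) p

/-- The upper bound `p^inn_{r,ρ}`. -/
def innBound {s : Scalars} {n : ℕ} (m r ρ : ℕ) [MeasurableSpace (SeqSpace n)]
    (γ : Measure (SeqSpace n)) (p : Poly s n) : EReal :=
  linearBound (innerCone m γ (quadModule s n m r ρ)) p

/-- The limit bound `p^inn_{∞,ρ}`. -/
def innBoundTop {s : Scalars} {n : ℕ} (m ρ : ℕ) [MeasurableSpace (SeqSpace n)]
    (γ : Measure (SeqSpace n)) (p : Poly s n) : EReal :=
  linearBound (innerCone m γ (quadModuleTop s n m ρ)) p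

end SobolevPOP

end

/-! The Fourier transform turns the ball into the ellipsoid of sequences with `∑ w_a |c_a|² ≤ 1`,
subject to `c_{-a} = conj c_a` in the real setting. For `m > 0` the weights tend to infinity, so the
ellipsoid is norm compact (`isCompact_ellipsoid`) and the continuous function `p` has a minimizer on
it.

Outer bounds. Positivity on the truncated module bounds by one all moments of degree at most `2r` in
low frequencies (`norm_apply_monomial_le_one`, by Cauchy–Schwarz). The other moments do not enter
and may be set to zero. This leaves a compact set, whence attainment; nested compact sets give
convergence to the bound of infinite order. That this bound equals the optimum is the dual form of
Putinar's Positivstellensatz. States of an archimedean module form a compact convex set. If `L` is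
an extreme state and `x` a suitably scaled Hermitian linear form, then `L` is a convex combination
of the normalized states `f ↦ L ((1 ± x/2) f)`, so that `L (x f) = L x * L f`. Thus extreme states
are point evaluations, and Krein–Milman yields one that minimizes `p`
(`exists_eval_re_le_of_mem_states`). One fixed `ρ` suffices: substituting zero for the high
frequencies keeps a point in the ellipsoid and does not change `p` (`exists_evalSeq_re_le`).

Inner bounds. They lie above the optimum since the densities are nonnegative on the ellipsoid. At
finite order the bound is the least generalized eigenvalue of a pair of quadratic forms on a
finite-dimensional space, one of them positive definite because `γ` charges all relatively open sets
(`linearBoundAttained_innerCone`). For convergence, powers of a squared polynomial that peaks at the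
low frequencies of a minimizer are admissible densities, and by Laplace's method they concentrate
there (`tendsto_moment_peakPoly`). -/

noncomputable section

namespace SobolevPOP

open MvPolynomial
open scoped ComplexOrder ComplexConjugate

/-! ### Conjugation of polynomials and spaces of bounded degree -/

section Involution

variable {σ : Type*} {τ : σ → σ}

/-- The conjugate-linear ring endomorphism of a polynomial ring that conjugates the coefficients
and renames the indeterminates by `τ`. -/
def conjRename (τ : σ → σ) : MvPolynomial σ ℂ →+* MvPolynomial σ ℂ :=
  (rename τ : MvPolynomial σ ℂ →ₐ[ℂ] MvPolynomial σ ℂ).toRingHom.comp (map (starRingEnd ℂ))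

@[simp] lemma conjRename_X (v : σ) : conjRename τ (X v) = X (τ v) := by simp [conjRename]

@[simp] lemma conjRename_C (z : ℂ) : conjRename τ (C z) = C (conj z) := by simp [conjRename]

lemma conjRename_smul (z : ℂ) (q : MvPolynomial σ ℂ) :
    conjRename τ (z • q) = conj z • conjRename τ q := by
  simp [smul_eq_C_mul]

lemma conjRename_monomial (α : σ →₀ ℕ) (z : ℂ) :
    conjRename τ (monomial α z) = monomial (α.mapDomain τ) (conj z) := by
  simp [conjRename, rename_monomial]

lemma eval_conjRename {z : σ → ℂ} (hz : ∀ v, z (τ v) = conj (z v)) (q : MvPolynomial σ ℂ) :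
    eval z (conjRename τ q) = conj (eval z q) := by
  induction q using MvPolynomial.induction_on with
  | C a => simp
  | add p q hp hq => simp [hp, hq]
  | mul_X p v hp => simp [hp, hz v]

/-- The polynomials of total degree at most `r` in the indeterminates from `W`. -/
def truncated (W : Set σ) (r : ℕ) : Submodule ℂ (MvPolynomial σ ℂ) :=
  restrictTotalDegree σ ℂ r ⊓ (supported ℂ W).toSubmodule

lemma mem_truncated {W : Set σ} {r : ℕ} {q : MvPolynomial σ ℂ} :
    q ∈ truncated W r ↔ q.totalDegree ≤ r ∧ ↑q.vars ⊆ W := by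
  rw [truncated, Submodule.mem_inf, mem_restrictTotalDegree, Subalgebra.mem_toSubmodule,
    mem_supported]

lemma truncated_mono {W : Set σ} {r k : ℕ} (h : r ≤ k) : truncated W r ≤ truncated W k :=
  fun _ hq => mem_truncated.2 ⟨(mem_truncated.1 hq).1.trans h, (mem_truncated.1 hq).2⟩

lemma mul_mem_truncated {W : Set σ} {r k : ℕ} {f g : MvPolynomial σ ℂ}
    (hf : f ∈ truncated W r) (hg : g ∈ truncated W k) : f * g ∈ truncated W (r + k) := by
  rw [mem_truncated, ← mem_supported] at *
  exact ⟨(totalDegree_mul _ _).trans (add_le_add hf.1 hg.1), mul_mem hf.2 hg.2⟩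

lemma C_mem_truncated (W : Set σ) (r : ℕ) (z : ℂ) : C z ∈ truncated W r :=
  mem_truncated.2 ⟨by simp, by simp⟩

lemma one_mem_truncated (W : Set σ) (r : ℕ) : (1 : MvPolynomial σ ℂ) ∈ truncated W r :=
  C_mem_truncated W r 1

lemma X_mem_truncated {W : Set σ} {v : σ} (hv : v ∈ W) :
    (X v : MvPolynomial σ ℂ) ∈ truncated W 1 :=
  mem_truncated.2 ⟨by simp, by simpa [vars_X] using hv⟩

lemma monomial_mem_truncated {W : Set σ} {r : ℕ} {α : σ →₀ ℕ} (h : α.degree ≤ r)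
    (hW : ↑α.support ⊆ W) (z : ℂ) : monomial α z ∈ truncated W r := by
  refine mem_truncated.2 ⟨(totalDegree_monomial_le _ _).trans h, fun v hv => hW ?_⟩
  by_cases hz : z = 0
  · simp [hz] at hv
  · rwa [vars_monomial hz] at hv

lemma conjRename_mem_truncated {W : Set σ} (hW : ∀ v ∈ W, τ v ∈ W) {r : ℕ}
    {q : MvPolynomial σ ℂ} (hq : q ∈ truncated W r) : conjRename τ q ∈ truncated W r := by
  classical
  rw [mem_truncated] at *
  have hs : (map (starRingEnd ℂ) q).support ⊆ q.support := support_map_subset _ _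
  have hd : (map (starRingEnd ℂ) q).totalDegree ≤ q.totalDegree :=
    Finset.sup_mono hs
  refine ⟨(totalDegree_rename_le _ _).trans (hd.trans hq.1), fun v hv => ?_⟩
  obtain ⟨u, hu, rfl⟩ := Finset.mem_image.1 (vars_rename τ _ hv)
  exact hW u (hq.2 (vars_map _ _ hu))

lemma degree_le_and_support_subset_of_mem_truncated {W : Set σ} {r : ℕ}
    {q : MvPolynomial σ ℂ} (hq : q ∈ truncated W r) {α : σ →₀ ℕ} (hα : α ∈ q.support) :
    α.degree ≤ r ∧ ↑α.support ⊆ W := by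
  rw [mem_truncated] at hq
  exact ⟨(le_totalDegree hα).trans hq.1, fun v hv =>
    hq.2 ((mem_vars_iff_mem_support v).2 ⟨α, hα, hv⟩)⟩

end Involution

/-! ### Positive functionals, extreme states and Krein–Milman -/

section PositiveFunctionals

variable {σ : Type*} {τ : σ → σ}

/-- A linear functional that is nonnegative on the squares from a subspace is Hermitian there. -/
lemma apply_conjRename_mul_comm {L : MvPolynomial σ ℂ →ₗ[ℂ] ℂ}
    {V : Submodule ℂ (MvPolynomial σ ℂ)}
    (hL : ∀ q ∈ V, 0 ≤ L (conjRename τ q * q)) {f g : MvPolynomial σ ℂ} (hf : f ∈ V)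
    (hg : g ∈ V) : L (conjRename τ g * f) = conj (L (conjRename τ f * g)) := by
  have key : ∀ q ∈ V, (L (conjRename τ q * q)).im = 0 := fun q hq =>
    (Complex.nonneg_iff.1 (hL q hq)).2.symm
  -- Polarization: the squares of `f + g` and of `f + i g` determine the imaginary and the real part
  -- of the cross term.
  have h1 := key _ (V.add_mem hf hg)
  have h2 := key _ (V.add_mem hf (V.smul_mem Complex.I hg))
  have hf0 := key _ hf
  have hg0 := key _ hg
  simp only [map_add, conjRename_smul, add_mul, mul_add, smul_mul_assoc, mul_smul_comm, map_smul,
    smul_eq_mul, Complex.add_im, Complex.mul_im, Complex.I_re, Complex.I_im, Complex.conj_I,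
    Complex.neg_re, Complex.neg_im, Complex.mul_re] at h1 h2
  apply Complex.ext
  · simp only [Complex.conj_re]; linarith
  · simp only [Complex.conj_im]; linarith

/-- Cauchy–Schwarz for the semi-inner product `L (f* g)`. With a phase `ω` that makes `ω L (f* g)`
equal to minus its modulus, positivity on `f + ω g` reads `0 ≤ L (f* f) - 2 |L (f* g)| + L (g* g)`.
-/
lemma norm_apply_conjRename_mul_le_one {L : MvPolynomial σ ℂ →ₗ[ℂ] ℂ}
    {V : Submodule ℂ (MvPolynomial σ ℂ)}
    (hL : ∀ q ∈ V, 0 ≤ L (conjRename τ q * q)) {f g : MvPolynomial σ ℂ} (hf : f ∈ V)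
    (hg : g ∈ V) (hf1 : (L (conjRename τ f * f)).re ≤ 1)
    (hg1 : (L (conjRename τ g * g)).re ≤ 1) : ‖L (conjRename τ f * g)‖ ≤ 1 := by
  set c := L (conjRename τ f * g) with hc
  by_cases h0 : c = 0
  · simp [h0]
  have hn : (‖c‖ : ℂ) ≠ 0 := by simpa using h0
  have hn' : ‖c‖ ≠ 0 := by simpa using h0
  set ω : ℂ := -(conj c / ‖c‖) with hω
  have hωc : ω * c = -(‖c‖ : ℂ) := by
    rw [hω, neg_mul, div_mul_eq_mul_div, mul_comm, Complex.mul_conj, Complex.normSq_eq_norm_sq]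
    push_cast
    field_simp
  have hωω : conj ω * ω = 1 := by
    rw [mul_comm, Complex.mul_conj, Complex.normSq_eq_norm_sq, hω]
    simp [hn']
  have h := (Complex.nonneg_iff.1 (hL _ (V.add_mem hf (V.smul_mem ω hg)))).1
  have hs := apply_conjRename_mul_comm hL hf hg
  have e : L (conjRename τ (f + ω • g) * (f + ω • g)) = L (conjRename τ f * f) +
      (ω * c + conj (ω * c)) + conj ω * ω * L (conjRename τ g * g) := by
    simp only [map_add, conjRename_smul, add_mul, mul_add, smul_mul_assoc, mul_smul_comm,
      map_smul, smul_eq_mul, hs, map_mul, ← hc]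
    ring
  rw [e, hωc, hωω] at h
  simp at h
  linarith

/-- A functional that is nonnegative on squares of bounded degree, also after multiplication with
`1 - X_v X_{τ v}`, is bounded by one on the monomials. -/
lemma norm_apply_monomial_le_one (hτ : Function.Involutive τ) {W : Set σ}
    (hW : ∀ v ∈ W, τ v ∈ W) {r : ℕ} {L : MvPolynomial σ ℂ →ₗ[ℂ] ℂ} (h1 : L 1 = 1)
    (hL : ∀ q ∈ truncated W r, 0 ≤ L (conjRename τ q * q))
    (hX : ∀ k < r, ∀ q ∈ truncated W k, ∀ v ∈ W,
      0 ≤ L (conjRename τ q * q * (1 - X v * X (τ v))))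
    {α : σ →₀ ℕ} (hα : α.degree ≤ 2 * r) (hαW : ↑α.support ⊆ W) :
    ‖L (monomial α 1)‖ ≤ 1 := by
  classical
  -- Squares of monomials first: splitting off one letter, `hX` shows that an additional factor `X_v
  -- X_{τ v}` does not increase the value.
  have sq : ∀ k ≤ r, ∀ β : σ →₀ ℕ, β.degree = k → ↑β.support ⊆ W →
      (L (conjRename τ (monomial β 1) * monomial β 1)).re ≤ 1 := by
    intro k
    induction k with
    | zero =>
      intro _ β hβ _
      have : β = 0 := (Finsupp.degree_eq_zero_iff β).1 hβ
      subst this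
      have h10 : (monomial (0 : σ →₀ ℕ) (1 : ℂ)) = 1 := rfl
      simp [h10, h1]
    | succ k ih =>
      intro hk β hβ hβW
      have hne : β ≠ 0 := by rintro rfl; simp at hβ
      obtain ⟨v, hv⟩ := Finsupp.support_nonempty_iff.2 hne
      have hle : Finsupp.single v 1 ≤ β := by
        rw [Finsupp.single_le_iff]
        exact Nat.one_le_iff_ne_zero.2 (Finsupp.mem_support_iff.1 hv)
      obtain ⟨γ, rfl⟩ := exists_add_of_le hle
      have hγ : γ.degree = k := by
        rw [map_add, Finsupp.degree_single] at hβ; omega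
      have hγW : ↑γ.support ⊆ W := fun u hu => hβW (by
        have : γ u ≠ 0 := by simpa using hu
        simp [this])
      have hmem : monomial γ (1 : ℂ) ∈ truncated W k :=
        monomial_mem_truncated hγ.le hγW 1
      have e : (monomial (Finsupp.single v 1 + γ) (1 : ℂ)) = X v * monomial γ 1 := by
        rw [X, monomial_mul, one_mul]
      have hx := (Complex.nonneg_iff.1 (hX k (by omega) _ hmem v (hβW hv))).1
      have := ih (by omega) γ hγ hγW
      rw [e, RingHom.map_mul, conjRename_X, show X (τ v) * conjRename τ (monomial γ 1) *
        (X v * monomial γ 1) = conjRename τ (monomial γ 1) * monomial γ 1 -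
        conjRename τ (monomial γ 1) * monomial γ 1 * (1 - X v * X (τ v)) by ring, map_sub,
        Complex.sub_re]
      linarith
  -- A monomial of degree at most `2r` is a product of two of degree at most `r`; Cauchy–Schwarz
  -- then applies, one factor being written as the conjugate of its image under `τ`.
  obtain ⟨β, hβα, hβ⟩ := Finsupp.exists_le_degree_eq α (min r α.degree) (min_le_right _ _)
  obtain ⟨γ, rfl⟩ := exists_add_of_le hβα
  have hβr : β.degree ≤ r := hβ.le.trans (min_le_left _ _)
  have hγr : γ.degree ≤ r := by
    rw [map_add] at hα hβ; omega
  have hβW : ↑β.support ⊆ W := fun u hu => hαW (by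
    have : β u ≠ 0 := by simpa using hu
    simp [this])
  have hγW : ↑γ.support ⊆ W := fun u hu => hαW (by
    have : γ u ≠ 0 := by simpa using hu
    simp [this])
  have hβ' : (β.mapDomain τ).degree ≤ r := by rwa [Finsupp.degree_mapDomain]
  have hβW' : ↑(β.mapDomain τ).support ⊆ W := fun u hu => by
    obtain ⟨v, hv, rfl⟩ := Finset.mem_image.1 (Finsupp.mapDomain_support hu)
    exact hW v (hβW hv)
  have e : monomial (β + γ) (1 : ℂ) =
      conjRename τ (monomial (β.mapDomain τ) 1) * monomial γ 1 := by
    rw [conjRename_monomial, ← Finsupp.mapDomain_comp, hτ.comp_self, Finsupp.mapDomain_id,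
      monomial_mul]
    simp
  rw [e]
  exact norm_apply_conjRename_mul_le_one hL (monomial_mem_truncated hβ' hβW' 1)
    (monomial_mem_truncated hγr hγW 1) (sq _ hβ' _ rfl hβW') (sq _ hγr _ rfl hγW)

/-- If `|a 0| > m > 0`, iteration gives `|a j| ≥ m (|a 0| / m) ^ 2 ^ j`, which is incompatible with
the upper bound `C`. For `m = 0` the first inequality alone forces `a 0 = 0`. -/
lemma abs_le_of_sq_le_mul_succ {a : ℕ → ℝ} {m C : ℝ} (hm : 0 ≤ m)
    (ha : ∀ j, a j ^ 2 ≤ m * a (j + 1)) (hC : ∀ j, a j ≤ C) : |a 0| ≤ m := by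
  by_contra! h
  rcases hm.eq_or_lt with rfl | hm
  · have := ha 0
    rw [zero_mul] at this
    have h0 : a 0 = 0 := by nlinarith
    simp [h0] at h
  have step : ∀ j, m * (|a 0| / m) ^ 2 ^ j ≤ |a j| := by
    intro j
    induction j with
    | zero => rw [pow_zero, pow_one, mul_div_cancel₀ _ hm.ne']
    | succ j ih =>
      have h1 : (m * (|a 0| / m) ^ 2 ^ j) ^ 2 ≤ |a j| ^ 2 :=
        pow_le_pow_left₀ (by positivity) ih 2
      rw [sq_abs] at h1
      have h2 := (h1.trans (ha j)).trans (mul_le_mul_of_nonneg_left (le_abs_self _) hm.le)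
      rw [mul_pow, ← pow_mul, ← pow_succ, sq, mul_assoc] at h2
      exact le_of_mul_le_mul_left h2 hm
  have ht : 1 < |a 0| / m := by rwa [one_lt_div hm]
  obtain ⟨N, hN⟩ := pow_unbounded_of_one_lt (C / m) ht
  have h1 : (|a 0| / m) ^ N ≤ (|a 0| / m) ^ 2 ^ (N + 1) :=
    pow_le_pow_right₀ ht.le (Nat.lt_two_pow_self.le.trans (Nat.pow_le_pow_right (by norm_num)
      (Nat.le_succ N)))
  have h2 := step (N + 1)
  have h3 : 0 ≤ a (N + 1) := by
    have := (sq_nonneg (a N)).trans (ha N)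
    exact nonneg_of_mul_nonneg_right this hm
  rw [abs_of_nonneg h3] at h2
  have h4 := h2.trans (hC (N + 1))
  have h5 : C < m * (|a 0| / m) ^ N := by rw [div_lt_iff₀ hm] at hN; linarith
  nlinarith

/-- If a Hermitian element `x` has bounded powers with respect to a functional `q ↦ L (q * g)` that
is nonnegative on squares, then `|L (x * g)| ≤ L g`. -/
lemma abs_apply_mul_le {L : MvPolynomial σ ℂ →ₗ[ℂ] ℂ} {g x : MvPolynomial σ ℂ}
    (hL : ∀ q, 0 ≤ L (conjRename τ q * q * g)) (hx : conjRename τ x = x) {K : ℝ}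
    (hK : ∀ k, ‖L (x ^ k * g)‖ ≤ K) :
    |(L (x * g)).re| ≤ (L g).re ∧ (L (x * g)).im = 0 := by
  let L' : MvPolynomial σ ℂ →ₗ[ℂ] ℂ := L ∘ₗ LinearMap.mulRight ℂ g
  have hL' : ∀ q, 0 ≤ L' (conjRename τ q * q) := fun q => by simpa [L'] using hL q
  have him : ∀ k, (L (x ^ k * g)).im = 0 := by
    intro k
    have h := apply_conjRename_mul_comm (V := ⊤) (fun q _ => hL' q)
      (Submodule.mem_top (x := x ^ k)) (Submodule.mem_top (x := 1))
    simp only [map_one, one_mul, map_pow, hx, mul_one, L', LinearMap.comp_apply,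
      LinearMap.mulRight_apply] at h
    exact Complex.conj_eq_iff_im.1 h.symm
  refine ⟨?_, by simpa using him 1⟩
  -- Positivity on `1 + s x^k` for all real `s`. The discriminant yields `L (x^k g)² ≤ L g * L
  -- (x^{2k} g)`, which is iterated along `k = 2 ^ j`.
  have hquad : ∀ k (s : ℝ), 0 ≤ (L (x ^ (2 * k) * g)).re * (s * s) +
      (2 * (L (x ^ k * g)).re) * s + (L g).re := by
    intro k s
    have h := (Complex.nonneg_iff.1 (hL (1 + (s : ℂ) • x ^ k))).1
    have e : conjRename τ (1 + (s : ℂ) • x ^ k) * (1 + (s : ℂ) • x ^ k) * g =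
        g + ((2 * s : ℝ) : ℂ) • (x ^ k * g) + ((s * s : ℝ) : ℂ) • (x ^ (2 * k) * g) := by
      rw [map_add, map_one, conjRename_smul, map_pow, hx, Complex.conj_ofReal]
      simp only [smul_eq_C_mul, Complex.ofReal_mul, map_mul, Complex.ofReal_ofNat]
      rw [show (C (2 : ℂ) : MvPolynomial σ ℂ) = 2 from map_ofNat C 2]
      ring
    rw [e, map_add, map_add, map_smul, map_smul, smul_eq_mul, smul_eq_mul, Complex.add_re,
      Complex.add_re, Complex.re_ofReal_mul, Complex.re_ofReal_mul] at h
    linarith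
  have hg : 0 ≤ (L g).re := by simpa using (hquad 0 0)
  have := abs_le_of_sq_le_mul_succ (a := fun j => (L (x ^ 2 ^ j * g)).re) (C := K) hg
    (fun j => ?_) (fun j => (Complex.re_le_norm _).trans (hK _))
  · simpa using this
  · have h := discrim_le_zero (hquad (2 ^ j))
    rw [discrim] at h
    rw [pow_succ 2 j, mul_comm (2 ^ j) 2]
    nlinarith

/-- The linear functional with prescribed values on the monomials. -/
def functional (y : (σ →₀ ℕ) → ℂ) : MvPolynomial σ ℂ →ₗ[ℂ] ℂ := (basisMonomials σ ℂ).constr ℂ y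

lemma functional_apply (y : (σ →₀ ℕ) → ℂ) (q : MvPolynomial σ ℂ) :
    functional y q = ∑ α ∈ q.support, q.coeff α * y α := by
  rw [functional, Module.Basis.constr_apply]
  rfl

lemma functional_monomial (y : (σ →₀ ℕ) → ℂ) (α : σ →₀ ℕ) :
    functional y (monomial α 1) = y α := by
  rw [functional, show monomial α (1 : ℂ) = basisMonomials σ ℂ α by rw [coe_basisMonomials],
    Module.Basis.constr_basis]

lemma functional_apply_monomial (L : MvPolynomial σ ℂ →ₗ[ℂ] ℂ) :
    functional (fun α => L (monomial α 1)) = L := by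
  refine (basisMonomials σ ℂ).ext fun α => ?_
  rw [coe_basisMonomials, functional_monomial]

lemma functional_eq {y : (σ →₀ ℕ) → ℂ} {L : MvPolynomial σ ℂ →ₗ[ℂ] ℂ}
    (h : ∀ α, y α = L (monomial α 1)) : functional y = L := by
  rw [funext h, functional_apply_monomial]

lemma continuous_functional (q : MvPolynomial σ ℂ) :
    Continuous fun y : (σ →₀ ℕ) → ℂ => functional y q := by
  simp only [functional_apply]
  fun_prop

/-- The normalized functionals that are nonnegative on the quadratic module generated by `G`. -/
def states (τ : σ → σ) (G : Set (MvPolynomial σ ℂ)) : Set ((σ →₀ ℕ) → ℂ) :=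
  {y | y 0 = 1 ∧ ∀ q, ∀ g ∈ G, 0 ≤ functional y (conjRename τ q * q * g)}

lemma norm_le_one_of_mem_states (hτ : Function.Involutive τ) {G : Set (MvPolynomial σ ℂ)}
    (h1 : 1 ∈ G) (hX : ∀ v, 1 - X v * X (τ v) ∈ G) {y : (σ →₀ ℕ) → ℂ} (hy : y ∈ states τ G)
    (α : σ →₀ ℕ) : ‖y α‖ ≤ 1 := by
  rw [← functional_monomial y α]
  refine norm_apply_monomial_le_one (W := Set.univ) (r := α.degree) hτ (by simp) ?_
    (fun q _ => by simpa using hy.2 q 1 h1) (fun k _ q _ v _ => hy.2 q _ (hX v)) (by omega)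
    (by simp)
  exact (functional_monomial y 0).trans hy.1

/-- By Tychonoff: the constraints are closed in the product topology and all moments lie in the unit
disc. -/
lemma isCompact_states (hτ : Function.Involutive τ) {G : Set (MvPolynomial σ ℂ)}
    (h1 : 1 ∈ G) (hX : ∀ v, 1 - X v * X (τ v) ∈ G) : IsCompact (states τ G) := by
  have hK : IsCompact (Set.univ.pi fun _ : σ →₀ ℕ => Metric.closedBall (0 : ℂ) 1) :=
    isCompact_univ_pi fun _ => isCompact_closedBall 0 1
  refine hK.of_isClosed_subset ?_ fun y hy α _ => by
    simpa using norm_le_one_of_mem_states hτ h1 hX hy α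
  have e : states τ G = {y | y 0 = 1} ∩
      ⋂ q, ⋂ g ∈ G, {y | 0 ≤ functional y (conjRename τ q * q * g)} := by
    ext y; simp [states]
  rw [e]
  refine (isClosed_eq (continuous_apply 0) continuous_const).inter ?_
  exact isClosed_iInter fun q => isClosed_biInter fun g _ =>
    isClosed_le continuous_const (continuous_functional _)

/-- Supplies the bounded powers needed in `abs_apply_mul_le`. Expanding one linear factor of a power
times a monomial gives a combination with coefficients `a`, `b` of two such products with a lower
power, and `‖a‖ + ‖b‖ ≤ 1` preserves the bound. -/
lemma norm_apply_pow_mul_le {L : MvPolynomial σ ℂ →ₗ[ℂ] ℂ} (hL : ∀ α, ‖L (monomial α 1)‖ ≤ 1)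
    {a b : ℂ} (hab : ‖a‖ + ‖b‖ ≤ 1) (v w : σ) (g : MvPolynomial σ ℂ) (k : ℕ) :
    ‖L ((a • X v + b • X w) ^ k * g)‖ ≤ ∑ α ∈ g.support, ‖g.coeff α‖ := by
  have key : ∀ k α, ‖L ((a • X v + b • X w) ^ k * monomial α 1)‖ ≤ 1 := by
    intro k
    induction k with
    | zero => simpa using hL
    | succ k ih =>
      intro α
      have e : (a • X v + b • X w) ^ (k + 1) * monomial α (1 : ℂ) =
          a • ((a • X v + b • X w) ^ k * monomial (Finsupp.single v 1 + α) 1) +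
          b • ((a • X v + b • X w) ^ k * monomial (Finsupp.single w 1 + α) 1) := by
        have (u : σ) : monomial (Finsupp.single u 1 + α) (1 : ℂ) = X u * monomial α 1 := by
          rw [X, monomial_mul, one_mul]
        rw [this, this, pow_succ]
        simp only [smul_eq_C_mul]
        ring
      rw [e, map_add, map_smul, map_smul]
      calc _ ≤ ‖a‖ * 1 + ‖b‖ * 1 := by
            refine (norm_add_le _ _).trans (add_le_add ?_ ?_) <;>
            · rw [norm_smul]
              exact mul_le_mul_of_nonneg_left (ih _) (norm_nonneg _)
        _ ≤ 1 := by linarith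
  conv_lhs => rw [g.as_sum, Finset.mul_sum, map_sum]
  refine (norm_sum_le _ _).trans (Finset.sum_le_sum fun α _ => ?_)
  rw [show monomial α (coeff α g) = coeff α g • monomial α (1 : ℂ) by
    rw [smul_monomial, smul_eq_mul, mul_one], mul_smul_comm, map_smul, norm_smul]
  exact mul_le_of_le_one_right (norm_nonneg _) (key k α)

/-- At an extreme state, multiplication by a Hermitian linear form factors out. -/
lemma apply_mul_of_mem_extremePoints (hτ : Function.Involutive τ) {G : Set (MvPolynomial σ ℂ)}
    (h1 : 1 ∈ G) (hX : ∀ v, 1 - X v * X (τ v) ∈ G) {y : (σ →₀ ℕ) → ℂ}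
    (hy : y ∈ (states τ G).extremePoints ℝ) {a b : ℂ} (hab : ‖a‖ + ‖b‖ ≤ 1) {v w : σ}
    (hx : conjRename τ (a • X v + b • X w) = a • X v + b • X w) (f : MvPolynomial σ ℂ) :
    functional y ((a • X v + b • X w) * f) =
      functional y (a • X v + b • X w) * functional y f := by
  set x : MvPolynomial σ ℂ := a • X v + b • X w with hxdef
  have hyS : y ∈ states τ G := hy.1
  set L := functional y with hLdef
  have hL1 : L 1 = 1 := (functional_monomial y 0).trans hyS.1
  have hbd : ∀ q, ∀ g ∈ G, |(L (x * (conjRename τ q * q * g))).re| ≤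
      (L (conjRename τ q * q * g)).re ∧ (L (x * (conjRename τ q * q * g))).im = 0 := by
    intro q g hg
    refine abs_apply_mul_le (fun p => ?_) hx fun k => norm_apply_pow_mul_le (fun α => ?_) hab v w _ k
    · have := hyS.2 (p * q) g hg
      rw [RingHom.map_mul] at this
      convert this using 2
      ring
    · rw [hLdef, functional_monomial]
      exact norm_le_one_of_mem_states hτ h1 hX hyS α
  have hx1 : |(L x).re| ≤ 1 ∧ (L x).im = 0 := by
    simpa [hL1] using hbd 1 1 h1
  set ξ := (L x).re with hξ
  have hLx : L x = (ξ : ℂ) := Complex.ext rfl (by simp [hx1.2])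
  -- the two states obtained by multiplication with `1 ± x / 2`
  have mk : ∀ t : ℝ, |t| = 1 / 2 → (0 < 1 + t * ξ) ∧
      (fun α => ((1 + t * ξ)⁻¹ : ℂ) * L ((1 + (t : ℂ) • x) * monomial α 1)) ∈ states τ G := by
    intro t ht
    have hpos : 0 < 1 + t * ξ := by
      have : |t * ξ| ≤ 1 / 2 := by
        rw [abs_mul, ht]; nlinarith [hx1.1, abs_nonneg ξ]
      linarith [neg_abs_le (t * ξ)]
    refine ⟨hpos, ?_, ?_⟩
    · have hne : (1 + t * ξ : ℂ) ≠ 0 := by exact_mod_cast hpos.ne'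
      change ((1 + t * ξ)⁻¹ : ℂ) * L ((1 + (t : ℂ) • x) * 1) = 1
      rw [mul_one, map_add, map_smul, hL1, hLx, smul_eq_mul, inv_mul_cancel₀ hne]
    · intro q g hg
      have hlin : functional (fun α => ((1 + t * ξ)⁻¹ : ℂ) * L ((1 + (t : ℂ) • x) * monomial α 1))
          = ((1 + t * ξ)⁻¹ : ℂ) • (L ∘ₗ LinearMap.mulLeft ℂ (1 + (t : ℂ) • x)) := by
        rw [← functional_apply_monomial
          (((1 + t * ξ)⁻¹ : ℂ) • (L ∘ₗ LinearMap.mulLeft ℂ (1 + (t : ℂ) • x)))]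
        rfl
      rw [hlin]
      simp only [LinearMap.smul_apply, LinearMap.comp_apply, LinearMap.mulLeft_apply, smul_eq_mul]
      refine mul_nonneg ?_ ?_
      · rw [show ((1 + t * ξ)⁻¹ : ℂ) = (((1 + t * ξ)⁻¹ : ℝ) : ℂ) by push_cast; rfl]
        exact Complex.zero_le_real.2 (inv_nonneg.2 hpos.le)
      · obtain ⟨hb, hb'⟩ := hbd q g hg
        have h0 := Complex.nonneg_iff.1 (hyS.2 q g hg)
        rw [add_mul, one_mul, smul_mul_assoc, map_add, map_smul, smul_eq_mul, Complex.nonneg_iff,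
          Complex.add_re, Complex.add_im, Complex.re_ofReal_mul, Complex.im_ofReal_mul, hb',
          mul_zero, add_zero]
        refine ⟨?_, h0.2⟩
        have : |t * (L (x * (conjRename τ q * q * g))).re| ≤ (L (conjRename τ q * q * g)).re := by
          rw [abs_mul, ht]; nlinarith [abs_nonneg (L (x * (conjRename τ q * q * g))).re]
        linarith [neg_abs_le (t * (L (x * (conjRename τ q * q * g))).re)]
  obtain ⟨hp1, hs1⟩ := mk (1 / 2) (by norm_num)
  obtain ⟨hp2, hs2⟩ := mk (-(1 / 2)) (by norm_num)
  -- The weights `(1 ± ξ/2) / 2` cancel the normalizations, so the two states average to `y`; they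
  -- are positive because `|ξ| ≤ 1`. Extremality identifies the first state with `y`, and comparing
  -- moments gives multiplicativity.
  have heq := (mem_extremePoints.1 hy).2 _ hs1 _ hs2
    ⟨(1 + 1 / 2 * ξ) / 2, (1 + -(1 / 2) * ξ) / 2, by linarith, by linarith, by ring, by
      have hne1 : (1 + (1 / 2 : ℝ) * ξ : ℂ) ≠ 0 := by exact_mod_cast hp1.ne'
      have hne2 : (1 + (-(1 / 2) : ℝ) * ξ : ℂ) ≠ 0 := by exact_mod_cast hp2.ne'
      funext α
      simp only [Pi.add_apply, Pi.smul_apply, Complex.real_smul]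
      rw [← functional_monomial y α, ← hLdef]
      rw [← mul_assoc, ← mul_assoc, show (((1 + 1 / 2 * ξ) / 2 : ℝ) : ℂ) *
        (1 + (1 / 2 : ℝ) * ξ : ℂ)⁻¹ = 1 / 2 by
          rw [← div_eq_mul_inv, div_eq_iff hne1]; push_cast; ring,
        show (((1 + -(1 / 2) * ξ) / 2 : ℝ) : ℂ) *
        (1 + (-(1 / 2) : ℝ) * ξ : ℂ)⁻¹ = 1 / 2 by
          rw [← div_eq_mul_inv, div_eq_iff hne2]; push_cast; ring]
      simp only [add_mul, one_mul, smul_mul_assoc, map_add, map_smul, smul_eq_mul]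
      push_cast
      ring⟩
  have hmono : ∀ α, L (x * monomial α 1) = L x * L (monomial α 1) := by
    intro α
    have hne1 : (1 + (1 / 2 : ℝ) * ξ : ℂ) ≠ 0 := by exact_mod_cast hp1.ne'
    have h := congrFun heq.1 α
    rw [← functional_monomial y α, ← hLdef, inv_mul_eq_iff_eq_mul₀ hne1] at h
    simp only [add_mul, one_mul, smul_mul_assoc, map_add, map_smul, smul_eq_mul] at h
    rw [hLx]
    push_cast at h
    linear_combination 2 * h
  have : L ∘ₗ LinearMap.mulLeft ℂ x = L x • L :=
    (basisMonomials σ ℂ).ext fun α => by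
      rw [coe_basisMonomials]
      simpa using hmono α
  simpa using LinearMap.congr_fun this f

/-- An extreme state of an archimedean quadratic module is an evaluation. -/
lemma exists_functional_eq_eval_of_mem_extremePoints (hτ : Function.Involutive τ)
    {G : Set (MvPolynomial σ ℂ)} (h1 : 1 ∈ G) (hX : ∀ v, 1 - X v * X (τ v) ∈ G)
    {y : (σ →₀ ℕ) → ℂ} (hy : y ∈ (states τ G).extremePoints ℝ) :
    ∃ z : σ → ℂ, (∀ v, z (τ v) = conj (z v)) ∧ ∀ q, functional y q = eval z q := by
  have hI : ‖(Complex.I / 2 : ℂ)‖ = 1 / 2 := by simp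
  have mulX : ∀ v f, functional y (X v * f) = functional y (X v) * functional y f := by
    intro v f
    -- `X_v = A - i B` with the Hermitian forms `A = (X_v + X_{τ v}) / 2` and `B = i (X_v - X_{τ v})
    -- / 2`, whose coefficients have moduli of sum one.
    have hA := apply_mul_of_mem_extremePoints hτ h1 hX hy (a := 1 / 2) (b := 1 / 2)
      (by norm_num) (v := v) (w := τ v)
      (by simp only [map_add, conjRename_smul, conjRename_X, hτ v]
          simp [add_comm, map_ofNat]) f
    have hB := apply_mul_of_mem_extremePoints hτ h1 hX hy (a := Complex.I / 2)
      (b := -(Complex.I / 2)) (by rw [norm_neg, hI]; norm_num) (v := v) (w := τ v)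
      (by simp only [map_add, conjRename_smul, conjRename_X, hτ v]
          simp [add_comm, neg_div, map_ofNat]) f
    simp only [add_mul, smul_mul_assoc, map_add, map_smul, smul_eq_mul] at hA hB
    linear_combination hA - Complex.I * hB +
      ((functional y (X v * f) - functional y (X (τ v) * f)) / 2 -
      (functional y (X v) - functional y (X (τ v))) * functional y f / 2) * Complex.I_sq
  refine ⟨fun v => functional y (X v), fun v => ?_, fun q => ?_⟩
  · have hL : ∀ q ∈ (⊤ : Submodule ℂ (MvPolynomial σ ℂ)),
        0 ≤ functional y (conjRename τ q * q) := fun q _ => by simpa using hy.1.2 q 1 h1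
    simpa using apply_conjRename_mul_comm hL (Submodule.mem_top (x := (1 : MvPolynomial σ ℂ)))
      (Submodule.mem_top (x := X v))
  · induction q using MvPolynomial.induction_on with
    | C a =>
      have : functional y 1 = 1 := (functional_monomial y 0).trans hy.1.1
      rw [C_eq_smul_one, map_smul, this]
      simp
    | add p q hp hq => simp [hp, hq]
    | mul_X p v hp => rw [mul_comm, mulX, hp]; simp

/-- The value of a polynomial at a state of an archimedean quadratic module is bounded below by its
value at some point where the generators are nonnegative. -/
theorem exists_eval_re_le_of_mem_states (hτ : Function.Involutive τ)
    {G : Set (MvPolynomial σ ℂ)} (h1 : 1 ∈ G) (hX : ∀ v, 1 - X v * X (τ v) ∈ G)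
    {y : (σ →₀ ℕ) → ℂ} (hy : y ∈ states τ G) (p : MvPolynomial σ ℂ) :
    ∃ z : σ → ℂ, (∀ v, z (τ v) = conj (z v)) ∧ (∀ g ∈ G, 0 ≤ eval z g) ∧
      (eval z p).re ≤ (functional y p).re := by
  have hcomp := isCompact_states hτ h1 hX
  -- The sign turns the minimizers of `p` into the face exposed by `l`. This face is compact and
  -- nonempty, so it has an extreme point, which is extreme among all states.
  let l : StrongDual ℝ ((σ →₀ ℕ) → ℂ) :=
    { toFun := fun y => -(functional y p).re
      map_add' := fun y y' => by
        simp [functional_apply, mul_add, Finset.sum_add_distrib]; ring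
      map_smul' := fun t y => by
        have : functional (t • y) p = (t : ℂ) * functional y p := by
          simp [functional_apply, Finset.mul_sum, mul_left_comm]
        rw [this, Complex.re_ofReal_mul]
        simp
      cont := (Complex.continuous_re.comp (continuous_functional p)).neg }
  have hexp : IsExposed ℝ (states τ G) {y ∈ states τ G | ∀ z ∈ states τ G, l z ≤ l y} :=
    fun _ => ⟨l, rfl⟩
  obtain ⟨y₁, hy₁S, hy₁⟩ := hcomp.exists_isMaxOn ⟨y, hy⟩ l.continuous.continuousOn
  obtain ⟨y₀, hy₀⟩ := (hexp.isCompact hcomp).extremePoints_nonempty ⟨y₁, hy₁S, hy₁⟩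
  obtain ⟨z, hz, hev⟩ := exists_functional_eq_eval_of_mem_extremePoints hτ h1 hX
    (hexp.isExtreme.extremePoints_subset_extremePoints hy₀)
  refine ⟨z, hz, fun g hg => ?_, ?_⟩
  · rw [← hev]
    simpa using hy₀.1.1.2 1 g hg
  · rw [← hev]
    have := hy₀.1.2 y hy
    change -(functional y p).re ≤ -(functional y₀ p).re at this
    linarith

end PositiveFunctionals

/-! ### Hermitian points are Zariski dense -/

section Vanishing

variable {σ : Type*} {τ : σ → σ}

/-- A polynomial that vanishes at all small Hermitian points is zero. -/
lemma eq_zero_of_eval_eq_zero (hτ : Function.Involutive τ) {ε : ℝ} (hε : 0 < ε)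
    {q : MvPolynomial σ ℂ}
    (hq : ∀ z : σ → ℂ, (∀ v, z (τ v) = conj (z v)) → (∀ v, ‖z v‖ ≤ ε) → eval z q = 0) :
    q = 0 := by
  -- This linear substitution sends every real point to a Hermitian one and has the left inverse
  -- `ψ`. It avoids choosing representatives of the `τ`-orbits and treats fixed points of `τ`
  -- uniformly.
  let φ : MvPolynomial σ ℂ →ₐ[ℂ] MvPolynomial σ ℂ :=
    aeval fun v => ((1 + Complex.I) / 2) • X v + ((1 - Complex.I) / 2) • X (τ v)
  let ψ : MvPolynomial σ ℂ →ₐ[ℂ] MvPolynomial σ ℂ :=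
    aeval fun v => ((1 - Complex.I) / 2) • X v + ((1 + Complex.I) / 2) • X (τ v)
  have hψφ : ψ.comp φ = AlgHom.id ℂ _ := by
    ext1 v
    simp only [AlgHom.comp_apply, φ, ψ, aeval_X, map_add, map_smul, hτ v, AlgHom.id_apply,
      smul_add, smul_smul]
    have h1 : (1 + Complex.I) / 2 * ((1 - Complex.I) / 2) = 1 / 2 := by
      linear_combination (-1 / 4 : ℂ) * Complex.I_sq
    have h2 : (1 + Complex.I) / 2 * ((1 + Complex.I) / 2) = Complex.I / 2 := by
      linear_combination (1 / 4 : ℂ) * Complex.I_sq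
    have h3 : (1 - Complex.I) / 2 * ((1 - Complex.I) / 2) = -(Complex.I / 2) := by
      linear_combination (1 / 4 : ℂ) * Complex.I_sq
    rw [h1, h2, h3, mul_comm ((1 - Complex.I) / 2), h1]
    module
  have hφ : φ q = 0 := by
    refine funext_set (fun _ => (fun t : ℝ => (t : ℂ)) '' Set.Icc (-(ε / 2)) (ε / 2)) (fun _ =>
      (Set.Icc_infinite (by linarith)).image Complex.ofReal_injective.injOn) fun x hx => ?_
    choose t ht htx using fun v => hx v trivial
    have hcomp : eval x (φ q) = eval (fun v => (1 + Complex.I) / 2 * x v +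
        (1 - Complex.I) / 2 * x (τ v)) q := by
      rw [← coe_aeval_eq_eval, RingHom.coe_coe, ← AlgHom.comp_apply, comp_aeval,
        ← coe_aeval_eq_eval]
      simp
    rw [hcomp, map_zero]
    refine hq _ (fun v => ?_) fun v => ?_
    · rw [hτ v, ← htx v, ← htx (τ v)]
      simp only [map_add, map_mul, map_div₀, map_sub, map_one, Complex.conj_I,
        Complex.conj_ofReal, map_ofNat]
      ring
    · have hx' : ∀ u, ‖x u‖ ≤ ε / 2 := fun u => by
        rw [← htx u, Complex.norm_real, Real.norm_eq_abs, abs_le]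
        exact ht u
      have hn : ∀ w : ℂ, ‖w‖ ≤ 2 → ∀ u, ‖w / 2 * x u‖ ≤ ε / 2 := fun w hw u => by
        rw [norm_mul, norm_div, Complex.norm_ofNat]
        have := hx' u
        nlinarith [norm_nonneg (x u), norm_nonneg w]
      have hp : ‖1 + Complex.I‖ ≤ 2 := (norm_add_le _ _).trans (by simp; norm_num)
      have hm : ‖1 - Complex.I‖ ≤ 2 := (norm_sub_le _ _).trans (by simp; norm_num)
      refine (norm_add_le _ _).trans ?_
      linarith [hn _ hp v, hn _ hm (τ v)]
  have := AlgHom.congr_fun hψφ q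
  rw [AlgHom.comp_apply, hφ, map_zero] at this
  exact this.symm

end Vanishing

attribute [local instance] instMeasureSpaceUnitAddCircle

/-! ### The Sobolev ball in Fourier coordinates and its compactness -/

section Fourier

variable {s : Scalars} {n m : ℕ}

lemma one_le_weight (m : ℕ) (a : Freq n) : 1 ≤ weight m a :=
  one_le_pow₀ (by have : 0 ≤ ∑ i, (a i : ℝ) ^ 2 := Finset.sum_nonneg fun _ _ => sq_nonneg _
                  linarith)

lemma weight_nonneg (m : ℕ) (a : Freq n) : 0 ≤ weight m a := zero_le_one.trans (one_le_weight m a)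

/-- For `m > 0` the weight dominates `1 + ∑ a_i²`, and `|a_i| ≤ a_i²` for integers. This growth is
what makes the ellipsoid compact. -/
lemma finite_setOf_weight_le (hm : 0 < m) (K : ℝ) : {a : Freq n | weight m a ≤ K}.Finite := by
  refine (Set.finite_Icc (fun _ : Fin n => -⌈K⌉) (fun _ => ⌈K⌉)).subset fun a ha => ?_
  have h0 : 0 ≤ ∑ i, (a i : ℝ) ^ 2 := Finset.sum_nonneg fun _ _ => sq_nonneg _
  have key : ∀ i, |a i| ≤ ⌈K⌉ := by
    intro i
    have h1 : (a i : ℝ) ^ 2 ≤ ∑ i, (a i : ℝ) ^ 2 :=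
      Finset.single_le_sum (f := fun i => (a i : ℝ) ^ 2) (fun _ _ => sq_nonneg _)
        (Finset.mem_univ i)
    have h2 : 1 + ∑ i, (a i : ℝ) ^ 2 ≤ weight m a := le_self_pow₀ (by linarith) hm.ne'
    have h3 : |a i| ≤ a i ^ 2 := by
      rw [← sq_abs]
      exact Int.le_self_sq _
    have h4 : ((|a i| : ℤ) : ℝ) ≤ (a i : ℝ) ^ 2 := by exact_mod_cast h3
    have ha' : weight m a ≤ K := ha
    exact_mod_cast (show ((|a i| : ℤ) : ℝ) ≤ ⌈K⌉ by linarith [Int.le_ceil K])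
  exact ⟨fun i => (abs_le.1 (key i)).1, fun i => (abs_le.1 (key i)).2⟩

lemma conjLetter_involutive : Function.Involutive (conjLetter : Letter s n → Letter s n) := by
  rintro (a | a | a) <;> simp [conjLetter]

/-- The sequences of Fourier coefficients that are compatible with the conjugation of the
indeterminates. -/
def IsHermitianSeq (s : Scalars) {n : ℕ} (c : Freq n → ℂ) : Prop :=
  ∀ v : Letter s n, letterValue c (conjLetter v) = conj (letterValue c v)

lemma isHermitianSeq_real {c : Freq n → ℂ} :
    IsHermitianSeq .real c ↔ ∀ a, c (-a) = conj (c a) :=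
  ⟨fun h a => h (.re a), by rintro h (a | a | a); exact h a⟩

lemma isHermitianSeq_complex (c : Freq n → ℂ) : IsHermitianSeq .complex c := by
  rintro (a | a | a) <;> simp [letterValue, conjLetter]

lemma mFourierCoeff_eq_repr (f : TorusL2 n) :
    UnitAddTorus.mFourierCoeff f = ⇑(UnitAddTorus.mFourierBasis.repr f) :=
  funext fun a => (UnitAddTorus.mFourierBasis_repr f a).symm

lemma mFourierCoeff_star (f : TorusL2 n) (a : Freq n) :
    UnitAddTorus.mFourierCoeff (star f : TorusL2 n) a =
      conj (UnitAddTorus.mFourierCoeff f (-a)) := by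
  rw [UnitAddTorus.mFourierCoeff, UnitAddTorus.mFourierCoeff, ← integral_conj]
  refine integral_congr_ae ?_
  filter_upwards [Lp.coeFn_star f] with x hx
  simp [hx, UnitAddTorus.mFourier_neg]

/-- Real-valued means `star f = f`; the Fourier transform is injective and turns `star` into
conjugation combined with `a ↦ -a`. -/
lemma ae_im_eq_zero_iff (f : TorusL2 n) :
    (∀ᵐ x, (f x).im = 0) ↔ IsHermitianSeq .real (UnitAddTorus.mFourierCoeff f) := by
  have h1 : (∀ᵐ x, (f x).im = 0) ↔ star f = f := by
    rw [Lp.ext_iff]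
    constructor
    · intro h
      filter_upwards [h, Lp.coeFn_star f] with x hx hs
      rw [hs]
      exact Complex.conj_eq_iff_im.2 hx
    · intro h
      filter_upwards [h, Lp.coeFn_star f] with x hx hs
      rw [hs] at hx
      exact Complex.conj_eq_iff_im.1 hx
  rw [h1, isHermitianSeq_real, ← (UnitAddTorus.mFourierBasis (d := Fin n)).repr.injective.eq_iff,
    lp.ext_iff, ← mFourierCoeff_eq_repr, ← mFourierCoeff_eq_repr, funext_iff]
  constructor
  · intro h a
    rw [← h (-a), mFourierCoeff_star, neg_neg]
  · intro h a
    rw [mFourierCoeff_star, h, Complex.conj_conj]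

lemma sobolevNormSq_le_one_iff (f : TorusL2 n) : sobolevNormSq m f ≤ 1 ↔
    ∀ F : Finset (Freq n), ∑ a ∈ F, weight m a * ‖UnitAddTorus.mFourierCoeff f a‖ ^ 2 ≤ 1 := by
  rw [sobolevNormSq, ENNReal.tsum_eq_iSup_sum, iSup_le_iff]
  refine forall_congr' fun F => ?_
  rw [← ENNReal.ofReal_sum_of_nonneg fun a _ => mul_nonneg (weight_nonneg m a) (sq_nonneg _),
    ENNReal.ofReal_le_one]

lemma mem_ball_iff (f : TorusL2 n) : f ∈ ball s n m ↔
    (∀ F : Finset (Freq n), ∑ a ∈ F, weight m a * ‖UnitAddTorus.mFourierCoeff f a‖ ^ 2 ≤ 1) ∧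
      IsHermitianSeq s (UnitAddTorus.mFourierCoeff f) := by
  rw [← sobolevNormSq_le_one_iff]
  cases s
  · exact and_congr_right fun _ => ae_im_eq_zero_iff f
  · exact (and_iff_left (isHermitianSeq_complex _)).symm

/-- The pointwise description of the Fourier ellipsoid. -/
def seqEllipsoid (s : Scalars) (n m : ℕ) : Set (Freq n → ℂ) :=
  {c | (∀ F : Finset (Freq n), ∑ a ∈ F, weight m a * ‖c a‖ ^ 2 ≤ 1) ∧ IsHermitianSeq s c}

/-- The Fourier transform is onto `ℓ₂`, so membership is a condition on the coefficients alone. -/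
lemma mem_ellipsoid_iff (c : SeqSpace n) : c ∈ ellipsoid s n m ↔ ⇑c ∈ seqEllipsoid s n m := by
  constructor
  · rintro ⟨f, hf, rfl⟩
    rw [mem_ball_iff, mFourierCoeff_eq_repr] at hf
    exact hf
  · intro hc
    refine ⟨UnitAddTorus.mFourierBasis.repr.symm c, ?_, by simp⟩
    rw [mem_ball_iff, mFourierCoeff_eq_repr, LinearIsometryEquiv.apply_symm_apply]
    exact hc

lemma sum_norm_sq_le_one {c : Freq n → ℂ} (hc : c ∈ seqEllipsoid s n m) (F : Finset (Freq n)) :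
    ∑ a ∈ F, ‖c a‖ ^ 2 ≤ 1 :=
  (Finset.sum_le_sum fun a _ => le_mul_of_one_le_left (sq_nonneg _) (one_le_weight m a)).trans
    (hc.1 F)

lemma norm_apply_le_one {c : Freq n → ℂ} (hc : c ∈ seqEllipsoid s n m) (a : Freq n) :
    ‖c a‖ ≤ 1 := by
  have := sum_norm_sq_le_one hc {a}
  rw [Finset.sum_singleton] at this
  exact (sq_le_one_iff₀ (norm_nonneg _)).1 this

lemma exists_mem_ellipsoid {c : Freq n → ℂ} (hc : c ∈ seqEllipsoid s n m) :
    ∃ x ∈ ellipsoid s n m, ⇑x = c := by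
  have h : Memℓp c 2 := memℓp_gen' (C := 1) fun F => by
    simpa using sum_norm_sq_le_one hc F
  exact ⟨⟨c, h⟩, (mem_ellipsoid_iff _).2 hc, rfl⟩

lemma evalFun_eq_evalSeq (p : Poly s n) (f : TorusL2 n) :
    evalFun p f = evalSeq p (UnitAddTorus.mFourierBasis.repr f : SeqSpace n) := by
  rw [evalFun, mFourierCoeff_eq_repr]

lemma optimum_eq (p : Poly s n) :
    optimum m p = ⨅ c ∈ ellipsoid s n m, ((evalSeq p c).re : EReal) := by
  rw [optimum, ellipsoid, iInf_image]
  simp only [evalFun_eq_evalSeq]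

lemma continuous_letterValue (v : Letter s n) :
    Continuous fun c : Freq n → ℂ => letterValue c v := by
  cases v <;> simp only [letterValue] <;> fun_prop

lemma continuous_evalSeq (p : Poly s n) : Continuous fun c : Freq n → ℂ => evalSeq p c :=
  (continuous_eval p).comp (continuous_pi continuous_letterValue)

lemma continuous_coe_seqSpace : Continuous fun c : SeqSpace n => (⇑c : Freq n → ℂ) :=
  (lp.uniformContinuous_coe (E := fun _ : Freq n => ℂ) (p := 2)).continuous

lemma isClosed_seqEllipsoid : IsClosed (seqEllipsoid s n m) := by
  have e : seqEllipsoid s n m =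
      (⋂ F : Finset (Freq n), {c | ∑ a ∈ F, weight m a * ‖c a‖ ^ 2 ≤ 1}) ∩
      ⋂ v : Letter s n, {c | letterValue c (conjLetter v) = conj (letterValue c v)} := by
    ext c; simp [seqEllipsoid, IsHermitianSeq]
  rw [e]
  refine (isClosed_iInter fun F => isClosed_le (by fun_prop) continuous_const).inter
    (isClosed_iInter fun v => isClosed_eq (continuous_letterValue _)
      (Complex.continuous_conj.comp (continuous_letterValue _)))

lemma isCompact_seqEllipsoid : IsCompact (seqEllipsoid s n m) :=
  (isCompact_univ_pi fun _ : Freq n => isCompact_closedBall (0 : ℂ) 1).of_isClosed_subset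
    isClosed_seqEllipsoid fun c hc a _ => by simpa using norm_apply_le_one hc a

/-- The bound on the weighted sums makes the tails uniformly small outside a finite set of
frequencies, and on that set coordinatewise convergence suffices. -/
lemma tendsto_of_tendsto_apply (hm : 0 < m) {x : ℕ → SeqSpace n} {c : SeqSpace n}
    (hx : ∀ k, x k ∈ ellipsoid s n m) (hc : c ∈ ellipsoid s n m)
    (h : ∀ a, Tendsto (fun k => x k a) atTop (𝓝 (c a))) : Tendsto x atTop (𝓝 c) := by
  classical
  rw [Metric.tendsto_nhds]
  intro ε hε
  -- Off `F` one has `1 ≤ ε² w_a / 16`, and `‖x - c‖² ≤ 2 ‖x‖² + 2 ‖c‖²` bounds the tail by `4 ε² /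
  -- 16`. With at most `ε² / 4` from `F` the total is below `(3 ε / 4)²`.
  set F : Finset (Freq n) := (finite_setOf_weight_le hm (16 / ε ^ 2)).toFinset with hF
  have h1 : Tendsto (fun k => ∑ a ∈ F, ‖x k a - c a‖ ^ 2) atTop (𝓝 0) := by
    have : Tendsto (fun k => ∑ a ∈ F, ‖x k a - c a‖ ^ 2) atTop (𝓝 (∑ a ∈ F, ‖c a - c a‖ ^ 2)) :=
      tendsto_finsetSum _ fun a _ => (((h a).sub_const (c a)).norm).pow 2
    simpa using this
  filter_upwards [h1.eventually (gt_mem_nhds (show (0 : ℝ) < ε ^ 2 / 4 by positivity))] with k hk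
  rw [dist_eq_norm]
  refine lt_of_le_of_lt (lp.norm_le_of_forall_sum_le (by norm_num)
    (C := ε * (3 / 4)) (by positivity) fun G => ?_) (by linarith)
  simp only [ENNReal.toReal_ofNat, Real.rpow_ofNat]
  have hxk := (mem_ellipsoid_iff _).1 (hx k)
  have hcc := (mem_ellipsoid_iff _).1 hc
  have htail : ∑ a ∈ G \ F, ‖x k a - c a‖ ^ 2 ≤ ε ^ 2 / 4 := by
    calc ∑ a ∈ G \ F, ‖x k a - c a‖ ^ 2
        ≤ ∑ a ∈ G \ F, ε ^ 2 / 16 *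
          (2 * (weight m a * ‖x k a‖ ^ 2) + 2 * (weight m a * ‖c a‖ ^ 2)) := by
          refine Finset.sum_le_sum fun a ha => ?_
          have hw : 16 / ε ^ 2 < weight m a := by
            have := (Finset.mem_sdiff.1 ha).2
            simpa [hF] using this
          have hw' : 1 ≤ ε ^ 2 / 16 * weight m a := by
            rw [div_lt_iff₀ (by positivity)] at hw
            linarith
          have hn : ‖x k a - c a‖ ^ 2 ≤ 2 * ‖x k a‖ ^ 2 + 2 * ‖c a‖ ^ 2 := by
            have := norm_sub_le (x k a) (c a)
            nlinarith [norm_nonneg (x k a - c a), sq_nonneg (‖x k a‖ - ‖c a‖)]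
          refine hn.trans ((le_mul_of_one_le_left (by positivity) hw').trans_eq ?_)
          ring
      _ = ε ^ 2 / 16 * (2 * ∑ a ∈ G \ F, weight m a * ‖x k a‖ ^ 2 +
          2 * ∑ a ∈ G \ F, weight m a * ‖c a‖ ^ 2) := by
          rw [← Finset.mul_sum, Finset.sum_add_distrib, Finset.mul_sum, Finset.mul_sum]
      _ ≤ ε ^ 2 / 4 := by nlinarith [hxk.1 (G \ F), hcc.1 (G \ F), sq_nonneg ε]
  have hsplit : ∑ a ∈ G, ‖x k a - c a‖ ^ 2 ≤
      ∑ a ∈ G \ F, ‖x k a - c a‖ ^ 2 + ∑ a ∈ F, ‖x k a - c a‖ ^ 2 := by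
    rw [← Finset.sum_union Finset.sdiff_disjoint, Finset.sdiff_union_self_eq_union]
    exact Finset.sum_le_sum_of_subset_of_nonneg Finset.subset_union_left fun _ _ _ => sq_nonneg _
  have : ∑ a ∈ G, ‖(x k - c) a‖ ^ 2 = ∑ a ∈ G, ‖x k a - c a‖ ^ 2 := rfl
  rw [this]
  nlinarith

/-- Rellich's theorem for the unit ball of the Sobolev space. -/
lemma isCompact_ellipsoid (hm : 0 < m) : IsCompact (ellipsoid s n m) := by
  rw [isCompact_iff_isSeqCompact]
  intro x hx
  obtain ⟨c, hc, φ, hφ, hlim⟩ := (isCompact_seqEllipsoid (s := s) (n := n) (m := m)).tendsto_subseq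
    (x := fun k => ⇑(x k)) fun k => (mem_ellipsoid_iff _).1 (hx k)
  obtain ⟨y, hy, rfl⟩ := exists_mem_ellipsoid hc
  exact ⟨y, hy, φ, hφ, tendsto_of_tendsto_apply hm (fun k => hx (φ k)) hy
    (tendsto_pi_nhds.1 hlim)⟩

lemma zero_mem_ellipsoid : (0 : SeqSpace n) ∈ ellipsoid s n m := by
  rw [mem_ellipsoid_iff]
  refine ⟨fun F => by simp, ?_⟩
  rintro (a | a | a) <;> simp [letterValue, conjLetter]

lemma exists_isMinOn_evalSeq (hm : 0 < m) (p : Poly s n) : ∃ c ∈ ellipsoid s n m,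
    ∀ c' ∈ ellipsoid s n m, (evalSeq p c).re ≤ (evalSeq p c').re := by
  obtain ⟨c, hc, hmin⟩ := (isCompact_ellipsoid (s := s) (n := n) hm).exists_isMinOn
    ⟨0, zero_mem_ellipsoid⟩ (Complex.continuous_re.comp
      ((continuous_evalSeq p).comp continuous_coe_seqSpace)).continuousOn
  exact ⟨c, hc, fun c' hc' => hmin hc'⟩

lemma optimum_eq_of_isMinOn {p : Poly s n} {c : SeqSpace n} (hc : c ∈ ellipsoid s n m)
    (hmin : ∀ c' ∈ ellipsoid s n m, (evalSeq p c).re ≤ (evalSeq p c').re) :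
    optimum m p = ((evalSeq p c).re : EReal) := by
  rw [optimum_eq]
  exact le_antisymm (iInf₂_le c hc) (le_iInf₂ fun c' hc' => EReal.coe_le_coe_iff.2 (hmin c' hc'))

end Fourier

/-! ### Low frequencies and the ball polynomial -/

section BallPoly

variable {s : Scalars} {n m ρ : ℕ}

/-- The indeterminates whose frequencies are bounded by `ρ`. -/
def lowLetters (s : Scalars) (n ρ : ℕ) : Set (Letter s n) := {v | ∀ i, (freq v i).natAbs ≤ ρ}

/-- The frequencies bounded by `ρ`. -/
def lowFreqs (n ρ : ℕ) : Finset (Freq n) :=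
  Finset.Icc (fun _ : Fin n => -(ρ : ℤ)) (fun _ : Fin n => (ρ : ℤ))

lemma mem_lowFreqs {a : Freq n} : a ∈ lowFreqs n ρ ↔ ∀ i, (a i).natAbs ≤ ρ := by
  rw [lowFreqs, Finset.mem_Icc, Pi.le_def, Pi.le_def, ← forall_and]
  exact forall_congr' fun i => by omega

lemma mem_lowLetters {v : Letter s n} : v ∈ lowLetters s n ρ ↔ freq v ∈ lowFreqs n ρ :=
  mem_lowFreqs.symm

lemma freq_coord (a : Freq n) : freq (coord s a) = a := by cases s <;> rfl

lemma conjLetter_mem_lowLetters {v : Letter s n} (hv : v ∈ lowLetters s n ρ) :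
    conjLetter v ∈ lowLetters s n ρ := by
  cases v <;> simpa [lowLetters, conjLetter, freq] using hv

lemma coord_mem_lowLetters {a : Freq n} : coord s a ∈ lowLetters s n ρ ↔ a ∈ lowFreqs n ρ := by
  rw [mem_lowLetters, freq_coord]

lemma finite_lowLetters : (lowLetters s n ρ).Finite := by
  have h : (lowLetters s n ρ) ⊆ ⋃ a ∈ lowFreqs n ρ, {coord s a, conjLetter (coord s a)} := by
    intro v hv
    rw [mem_lowLetters] at hv
    simp only [Set.mem_iUnion]
    refine ⟨freq v, hv, ?_⟩
    cases v <;> simp [freq, coord, conjLetter]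
  exact (Set.Finite.biUnion (lowFreqs n ρ).finite_toSet fun a _ => Set.toFinite _).subset h

lemma harmonicDegree_le_iff {q : Poly s n} :
    harmonicDegree q ≤ ρ ↔ ↑q.vars ⊆ lowLetters s n ρ := by
  simp only [harmonicDegree, Finset.sup_le_iff, Finset.mem_univ, true_implies]
  rfl

lemma mem_truncated_lowLetters {r : ℕ} {q : Poly s n} : q ∈ truncated (lowLetters s n ρ) r ↔
    algebraicDegree q ≤ r ∧ harmonicDegree q ≤ ρ := by
  rw [mem_truncated, harmonicDegree_le_iff, algebraicDegree]

lemma X_mul_X_conjLetter (v : Letter s n) : (X v * X (conjLetter v) : Poly s n) =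
    X (coord s (freq v)) * X (conjLetter (coord s (freq v))) := by
  cases v <;> simp [freq, coord, conjLetter, mul_comm]

lemma ballPoly_eq : ballPoly s n m ρ = 1 - ∑ a ∈ lowFreqs n ρ,
    C (weight m a : ℂ) * (X (coord s a) * X (conjLetter (coord s a))) := rfl

lemma ballPoly_mem_truncated : ballPoly s n m ρ ∈ truncated (lowLetters s n ρ) 2 := by
  have key : ∀ a ∈ lowFreqs n ρ, (C (weight m a : ℂ) *
      (X (coord s a) * X (conjLetter (coord s a))) : Poly s n) ∈
        truncated (lowLetters s n ρ) (0 + (1 + 1)) := fun a ha =>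
    have h := (coord_mem_lowLetters (s := s)).2 ha
    mul_mem_truncated (C_mem_truncated _ 0 _) (mul_mem_truncated (X_mem_truncated h)
      (X_mem_truncated (conjLetter_mem_lowLetters h)))
  rw [ballPoly_eq]
  exact sub_mem (one_mem_truncated _ _) (sum_mem key)

lemma letterValue_coord (c : Freq n → ℂ) (a : Freq n) : letterValue c (coord s a) = c a := by
  cases s <;> rfl

lemma evalSeq_ballPoly {c : Freq n → ℂ} (hc : IsHermitianSeq s c) :
    evalSeq (ballPoly s n m ρ) c = ((1 - ∑ a ∈ lowFreqs n ρ, weight m a * ‖c a‖ ^ 2 : ℝ) : ℂ) := by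
  rw [ballPoly_eq, evalSeq]
  simp only [map_sub, map_one, map_sum, map_mul, eval_C, eval_X, hc _, letterValue_coord,
    Complex.mul_conj, Complex.normSq_eq_norm_sq]
  push_cast
  rfl

/-- The restriction of a point to the frequencies bounded by `ρ`. -/
def lowSeq (ρ : ℕ) (z : Letter s n → ℂ) : Freq n → ℂ := by
  classical exact fun a => if a ∈ lowFreqs n ρ then z (coord s a) else 0

lemma isHermitianSeq_lowSeq {z : Letter s n → ℂ} (hz : ∀ v, z (conjLetter v) = conj (z v)) :
    IsHermitianSeq s (lowSeq ρ z) := by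
  cases s
  · rw [isHermitianSeq_real]
    intro a
    have h : -a ∈ lowFreqs n ρ ↔ a ∈ lowFreqs n ρ := by simp [mem_lowFreqs]
    by_cases ha : a ∈ lowFreqs n ρ
    · simp only [lowSeq, h, ha, if_true]
      exact hz (.re a)
    · simp [lowSeq, h, ha]
  · exact isHermitianSeq_complex _

lemma letterValue_lowSeq {z : Letter s n → ℂ} (hz : ∀ v, z (conjLetter v) = conj (z v))
    {v : Letter s n} (hv : v ∈ lowLetters s n ρ) : letterValue (lowSeq ρ z) v = z v := by
  rw [mem_lowLetters] at hv
  cases v with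
  | re a => simp only [freq] at hv; simp [letterValue, lowSeq, hv, coord]
  | co a => simp only [freq] at hv; simp [letterValue, lowSeq, hv, coord]
  | conjCo a =>
    simp only [freq] at hv
    simp only [letterValue, lowSeq, hv, if_true]
    exact (hz (.co a)).symm

lemma evalSeq_congr {q : Poly s n} (hq : ↑q.vars ⊆ lowLetters s n ρ) {c : Freq n → ℂ}
    {z : Letter s n → ℂ} (h : ∀ v ∈ lowLetters s n ρ, letterValue c v = z v) :
    evalSeq q c = eval z q :=
  eval₂Hom_congr' rfl (fun v hv _ => h v (hq hv)) rfl

lemma vars_ballPoly_subset : ↑(ballPoly s n m ρ).vars ⊆ lowLetters s n ρ :=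
  (mem_truncated.1 ballPoly_mem_truncated).2

/-- After truncation the infinitely many ellipsoid inequalities reduce to the single one expressed
by the ball polynomial. -/
lemma lowSeq_mem_seqEllipsoid {z : Letter s n → ℂ} (hz : ∀ v, z (conjLetter v) = conj (z v))
    (hb : 0 ≤ eval z (ballPoly s n m ρ)) : lowSeq ρ z ∈ seqEllipsoid s n m := by
  classical
  have hH := isHermitianSeq_lowSeq (ρ := ρ) hz
  refine ⟨fun F => ?_, hH⟩
  rw [← evalSeq_congr (c := lowSeq ρ z) vars_ballPoly_subset fun v hv => letterValue_lowSeq hz hv,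
    evalSeq_ballPoly hH, Complex.zero_le_real] at hb
  calc ∑ a ∈ F, weight m a * ‖lowSeq ρ z a‖ ^ 2
      = ∑ a ∈ F ∩ lowFreqs n ρ, weight m a * ‖lowSeq ρ z a‖ ^ 2 := by
        refine (Finset.sum_subset Finset.inter_subset_left fun a ha ha' => ?_).symm
        have : a ∉ lowFreqs n ρ := fun h => ha' (Finset.mem_inter.2 ⟨ha, h⟩)
        simp [lowSeq, this]
    _ ≤ ∑ a ∈ lowFreqs n ρ, weight m a * ‖lowSeq ρ z a‖ ^ 2 :=
        Finset.sum_le_sum_of_subset_of_nonneg Finset.inter_subset_right fun a _ _ =>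
          mul_nonneg (weight_nonneg m a) (sq_nonneg _)
    _ ≤ 1 := by linarith

end BallPoly

/-! ### The truncated quadratic modules -/

section QuadraticModule

variable {s : Scalars} {n m r ρ : ℕ}

/-- Phrased with some `k < r` instead of `r - 1`, so that the set is empty for `r = 0`. -/
lemma setOf_degree_lt_eq : {q : Poly s n | algebraicDegree q < r ∧ harmonicDegree q ≤ ρ} =
    {q | ∃ k < r, q ∈ truncated (lowLetters s n ρ) k} := by
  ext q
  simp only [Set.mem_ofPred_eq, mem_truncated_lowLetters]
  exact ⟨fun h => ⟨_, h.1, le_rfl, h.2⟩, fun ⟨k, hk, h⟩ => ⟨h.1.trans_lt hk, h.2⟩⟩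

lemma setOf_degree_le_eq : {q : Poly s n | algebraicDegree q ≤ r ∧ harmonicDegree q ≤ ρ} =
    truncated (lowLetters s n ρ) r := by
  ext q
  exact mem_truncated_lowLetters.symm

lemma apply_sumsOfSquares_nonneg {S : Set (Poly s n)} {L : Poly s n →ₗ[ℂ] ℂ}
    {b : Poly s n} (h : ∀ q ∈ S, 0 ≤ L (conjRename conjLetter q * q * b)) {g : Poly s n}
    (hg : g ∈ sumsOfSquares S) : 0 ≤ L (g * b) := by
  refine AddSubmonoid.closure_induction (motive := fun g _ => 0 ≤ L (g * b)) ?_ ?_ ?_ hg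
  · rintro _ ⟨q, hq, rfl⟩
    exact h q hq
  · simp
  · intro x y _ _ hx hy
    rw [add_mul, map_add]
    exact add_nonneg hx hy

lemma zero_mem_sumsOfSquares (S : Set (Poly s n)) : (0 : Poly s n) ∈ sumsOfSquares S :=
  zero_mem (AddSubmonoid.closure _)

lemma sq_mem_sumsOfSquares {S : Set (Poly s n)} {q : Poly s n} (hq : q ∈ S) :
    conjRename conjLetter q * q ∈ sumsOfSquares S :=
  AddSubmonoid.subset_closure ⟨q, hq, rfl⟩

lemma sumsOfSquares_mono {S T : Set (Poly s n)} (h : S ⊆ T) :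
    sumsOfSquares S ⊆ sumsOfSquares T :=
  AddSubmonoid.closure_mono fun _ ⟨q, hq, e⟩ => ⟨q, h hq, e⟩

/-- Nonnegativity on the quadratic module can be tested on its generators. -/
lemma forall_quadModule_nonneg_iff (L : Poly s n →ₗ[ℂ] ℂ) :
    (∀ g ∈ quadModule s n m r ρ, 0 ≤ L g) ↔
      (∀ q ∈ truncated (lowLetters s n ρ) r, 0 ≤ L (conjRename conjLetter q * q)) ∧
      ∀ k < r, ∀ q ∈ truncated (lowLetters s n ρ) k,
        0 ≤ L (conjRename conjLetter q * q * ballPoly s n m ρ) := by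
  constructor
  · refine fun h => ⟨fun q hq => h _ ?_, fun k hk q hq => h _ ?_⟩
    · refine ⟨_, sq_mem_sumsOfSquares ?_, 0, zero_mem_sumsOfSquares _, by ring⟩
      rw [setOf_degree_le_eq]
      exact hq
    · refine ⟨0, zero_mem_sumsOfSquares _, _, sq_mem_sumsOfSquares ?_, (zero_add _).symm⟩
      rw [setOf_degree_lt_eq]
      exact ⟨k, hk, hq⟩
  · rintro ⟨h0, h1⟩ _ ⟨s₀, hs₀, s₁, hs₁, rfl⟩
    rw [setOf_degree_le_eq] at hs₀
    rw [setOf_degree_lt_eq] at hs₁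
    rw [map_add]
    refine add_nonneg ?_ (apply_sumsOfSquares_nonneg (fun q hq => ?_) hs₁)
    · rw [← mul_one s₀]
      exact apply_sumsOfSquares_nonneg (fun q hq => by simpa using h0 q hq) hs₀
    · obtain ⟨k, hk, hq⟩ := hq
      exact h1 k hk q hq

lemma quadModule_mono {k : ℕ} (h : k ≤ r) : quadModule s n m k ρ ⊆ quadModule s n m r ρ := by
  rintro _ ⟨s₀, hs₀, s₁, hs₁, rfl⟩
  refine ⟨s₀, sumsOfSquares_mono ?_ hs₀, s₁, sumsOfSquares_mono ?_ hs₁, rfl⟩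
  · exact fun q hq => ⟨hq.1.trans h, hq.2⟩
  · exact fun q hq => ⟨hq.1.trans_le h, hq.2⟩

lemma evalSeq_nonneg_of_mem_quadModule {g : Poly s n} (hg : g ∈ quadModule s n m r ρ)
    {c : Freq n → ℂ} (hc : c ∈ seqEllipsoid s n m) : 0 ≤ evalSeq g c := by
  have hsq : ∀ q : Poly s n, 0 ≤ eval (letterValue c) (conjRename conjLetter q * q) := fun q => by
    rw [map_mul, eval_conjRename hc.2, mul_comm, Complex.mul_conj]
    exact Complex.zero_le_real.2 (Complex.normSq_nonneg _)
  have := (forall_quadModule_nonneg_iff (m := m) (r := r) (ρ := ρ)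
    (aeval (letterValue c) : Poly s n →ₐ[ℂ] ℂ).toLinearMap).2
    ⟨fun q _ => by simpa [aeval_eq_eval] using hsq q, fun k _ q _ => by
      simp only [AlgHom.toLinearMap_apply, aeval_eq_eval]
      rw [map_mul]
      refine mul_nonneg (hsq q) ?_
      rw [← evalSeq, evalSeq_ballPoly hc.2, Complex.zero_le_real]
      linarith [hc.1 (lowFreqs n ρ)]⟩ g hg
  simpa [aeval_eq_eval, evalSeq] using this

/-- The archimedean property, with control of degrees: `1 - |c_a|²` is the ball polynomial plus `∑
w_b |c_b|² - |c_a|²`. Multiplied by `q* q`, the latter is a nonnegative combination of squares of `q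
c_b`, of degree at most `k + 1 ≤ r`, because `w_a ≥ 1`. -/
lemma apply_one_sub_X_mul_X_nonneg {L : Poly s n →ₗ[ℂ] ℂ}
    (hL : ∀ g ∈ quadModule s n m r ρ, 0 ≤ L g) {k : ℕ} (hk : k < r) {q : Poly s n}
    (hq : q ∈ truncated (lowLetters s n ρ) k) {v : Letter s n} (hv : v ∈ lowLetters s n ρ) :
    0 ≤ L (conjRename conjLetter q * q * (1 - X v * X (conjLetter v))) := by
  rw [forall_quadModule_nonneg_iff] at hL
  set t : Freq n → ℂ := fun a =>
    L (conjRename conjLetter q * q * (X (coord s a) * X (conjLetter (coord s a)))) with ht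
  have ht0 : ∀ a ∈ lowFreqs n ρ, 0 ≤ t a := by
    intro a ha
    have hv : coord s a ∈ lowLetters s n ρ := coord_mem_lowLetters.2 ha
    have hmem : q * X (coord s a) ∈ truncated (lowLetters s n ρ) (k + 1) :=
      mul_mem_truncated hq (X_mem_truncated hv)
    have h := hL.1 _ (truncated_mono hk hmem)
    rw [RingHom.map_mul, conjRename_X] at h
    rw [ht]
    convert h using 2
    ring
  have hw : ∀ a : Freq n, (1 : ℂ) ≤ weight m a := fun a => by exact_mod_cast one_le_weight m a
  have e : conjRename conjLetter q * q * (1 - X v * X (conjLetter v)) =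
      conjRename conjLetter q * q * ballPoly s n m ρ + (∑ a ∈ lowFreqs n ρ, (weight m a : ℂ) •
        (conjRename conjLetter q * q * (X (coord s a) * X (conjLetter (coord s a)))) -
      conjRename conjLetter q * q *
        (X (coord s (freq v)) * X (conjLetter (coord s (freq v))))) := by
    rw [X_mul_X_conjLetter, ballPoly_eq]
    simp only [smul_eq_C_mul, mul_sub, Finset.mul_sum, mul_one]
    simp only [mul_left_comm _ (C _)]
    ring
  rw [e, map_add, map_sub, map_sum]
  simp only [map_smul, smul_eq_mul]
  refine add_nonneg (hL.2 k hk q hq) (sub_nonneg.2 ?_)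
  have hf := mem_lowLetters.1 hv
  calc t (freq v) ≤ (weight m (freq v) : ℂ) * t (freq v) :=
        le_mul_of_one_le_left (ht0 _ hf) (hw _)
    _ ≤ ∑ a ∈ lowFreqs n ρ, (weight m a : ℂ) * t a :=
        Finset.single_le_sum (f := fun a => (weight m a : ℂ) * t a)
          (fun a ha => mul_nonneg (zero_le_one.trans (hw a)) (ht0 a ha)) hf

end QuadraticModule

/-! ### The outer bounds -/

section OuterCone

variable {s : Scalars} {n m r ρ : ℕ}

lemma riesz_eq_functional (y : MomentSeq s n) (q : Poly s n) : riesz y q = functional y q :=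
  (functional_apply y q).symm

lemma mem_outerCone_iff {Q : Set (Poly s n)} {y : MomentSeq s n} :
    y ∈ outerCone Q ↔ ∀ g ∈ Q, 0 ≤ functional y g := by
  simp only [outerCone, Set.mem_ofPred_eq, Complex.nonneg_iff, riesz_eq_functional,
    eq_comm (a := (0 : ℝ))]

lemma outerCone_anti {Q Q' : Set (Poly s n)} (h : Q ⊆ Q') :
    outerCone Q' ⊆ outerCone Q := fun _ hy g hg => hy g (h hg)

lemma linearBound_anti {K K' : Set (MomentSeq s n)} (h : K ⊆ K') (p : Poly s n) :
    linearBound K' p ≤ linearBound K p :=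
  biInf_mono fun _ hy => ⟨h hy.1, hy.2⟩

lemma quadModule_subset_top : quadModule s n m r ρ ⊆ quadModuleTop s n m ρ :=
  Set.subset_iUnion (fun r => quadModule s n m r ρ) r

lemma functional_evalSeq (c : Freq n → ℂ) (q : Poly s n) :
    functional (fun α => evalSeq (monomial α 1 : Poly s n) c) q = evalSeq q c := by
  have := functional_apply_monomial (aeval (letterValue c) : Poly s n →ₐ[ℂ] ℂ).toLinearMap
  simp only [AlgHom.toLinearMap_apply, aeval_eq_eval] at this
  exact LinearMap.congr_fun this q

lemma evalSeq_mem_outerCone {c : Freq n → ℂ} (hc : c ∈ seqEllipsoid s n m) :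
    (fun α => evalSeq (monomial α 1 : Poly s n) c) ∈
      normalized (outerCone (quadModuleTop s n m ρ)) := by
  refine ⟨mem_outerCone_iff.2 fun g hg => ?_, ?_⟩
  · obtain ⟨r, hr⟩ := Set.mem_iUnion.1 hg
    rw [functional_evalSeq]
    exact evalSeq_nonneg_of_mem_quadModule hr hc
  · exact map_one (eval (letterValue c))

/-- The elements of the truncated outer cone that are normalized and bounded by one. -/
def boundedOuter (s : Scalars) (n m r ρ : ℕ) : Set (MomentSeq s n) :=
  {y | (∀ α, ‖y α‖ ≤ 1) ∧ y ∈ normalized (outerCone (quadModule s n m r ρ))}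

lemma isClosed_boundedOuter : IsClosed (boundedOuter s n m r ρ) := by
  have e : boundedOuter s n m r ρ = (⋂ α, {y | ‖y α‖ ≤ 1}) ∩
      ((⋂ g ∈ quadModule s n m r ρ, {y | 0 ≤ functional y g}) ∩ {y | y 0 = 1}) := by
    ext y; simp [boundedOuter, normalized, mem_outerCone_iff]
  rw [e]
  refine (isClosed_iInter fun α => isClosed_le (by fun_prop) continuous_const).inter
    ((isClosed_biInter fun g _ => isClosed_le continuous_const (continuous_functional g)).inter
      (isClosed_eq (continuous_apply 0) continuous_const))

lemma isCompact_boundedOuter : IsCompact (boundedOuter s n m r ρ) :=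
  (isCompact_univ_pi fun _ : Letter s n →₀ ℕ => isCompact_closedBall (0 : ℂ) 1).of_isClosed_subset
    isClosed_boundedOuter fun y hy α _ => by simpa using hy.1 α

/-- Only the moments up to degree `2 r` matter for the truncated outer cone. -/
lemma exists_mem_boundedOuter {y : MomentSeq s n}
    (hy : y ∈ normalized (outerCone (quadModule s n m r ρ))) :
    ∃ y' ∈ boundedOuter s n m r ρ, ∀ q ∈ truncated (lowLetters s n ρ) (2 * r),
      functional y' q = functional y q := by
  classical
  -- The generators `q* q` and `q* q b` of the module have degree at most `2r` and low frequencies,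
  -- so they do not see the moments replaced by zero.
  let y' : MomentSeq s n := fun α =>
    if α.degree ≤ 2 * r ∧ ↑α.support ⊆ lowLetters s n ρ then y α else 0
  have hyy' : ∀ q ∈ truncated (lowLetters s n ρ) (2 * r), functional y' q = functional y q := by
    intro q hq
    rw [functional_apply, functional_apply]
    refine Finset.sum_congr rfl fun α hα => ?_
    simp only [y', if_pos (degree_le_and_support_subset_of_mem_truncated hq hα)]
  have hpos := mem_outerCone_iff.1 hy.1
  have hpos' := (forall_quadModule_nonneg_iff _).1 hpos
  have h1 : functional y 1 = 1 := (functional_monomial y 0).trans hy.2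
  refine ⟨y', ⟨fun α => ?_, mem_outerCone_iff.2 ((forall_quadModule_nonneg_iff _).2
    ⟨fun q hq => ?_, fun k hk q hq => ?_⟩), ?_⟩, hyy'⟩
  · by_cases h : α.degree ≤ 2 * r ∧ ↑α.support ⊆ lowLetters s n ρ
    · simp only [y', if_pos h]
      rw [← functional_monomial y]
      exact norm_apply_monomial_le_one conjLetter_involutive
        (fun v hv => conjLetter_mem_lowLetters hv) h1 hpos'.1
        (fun k hk q hq v hv => apply_one_sub_X_mul_X_nonneg hpos hk hq hv) h.1 h.2
    · simp [y', if_neg h]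
  · rw [hyy' _ (truncated_mono (by omega) (mul_mem_truncated
      (conjRename_mem_truncated (fun v hv => conjLetter_mem_lowLetters hv) hq) hq))]
    exact hpos'.1 q hq
  · rw [hyy' _ (truncated_mono (by omega) (mul_mem_truncated (mul_mem_truncated
      (conjRename_mem_truncated (fun v hv => conjLetter_mem_lowLetters hv) hq) hq)
      ballPoly_mem_truncated))]
    exact hpos'.2 k hk q hq
  · simp [y', hy.2]

lemma normalized_outerCone_nonempty :
    (normalized (outerCone (quadModule s n m r ρ))).Nonempty :=
  have h := evalSeq_mem_outerCone (s := s) (n := n) (m := m) (ρ := ρ)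
    ((mem_ellipsoid_iff _).1 zero_mem_ellipsoid)
  ⟨_, outerCone_anti quadModule_subset_top h.1, h.2⟩

/-- The normalized cone is not compact, as its remaining moments are free. Minimizing over its
bounded part loses nothing, since every element agrees on `p` with a bounded one. -/
lemma exists_mem_boundedOuter_eq_outBound {p : Poly s n}
    (hp : p ∈ truncated (lowLetters s n ρ) r) :
    ∃ y ∈ boundedOuter s n m r ρ, ((riesz y p).re : EReal) = outBound m r ρ p := by
  obtain ⟨y₀, hy₀⟩ := normalized_outerCone_nonempty (s := s) (n := n) (m := m) (r := r) (ρ := ρ)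
  obtain ⟨y₁, hy₁, -⟩ := exists_mem_boundedOuter hy₀
  obtain ⟨y, hy, hmin⟩ := isCompact_boundedOuter.exists_isMinOn ⟨y₁, hy₁⟩
    (Complex.continuous_re.comp (continuous_functional p)).continuousOn
  refine ⟨y, hy, le_antisymm (le_iInf₂ fun x hx => ?_) (iInf₂_le y hy.2)⟩
  obtain ⟨x', hx', e⟩ := exists_mem_boundedOuter hx
  rw [EReal.coe_le_coe_iff, riesz_eq_functional, riesz_eq_functional,
    ← e p (truncated_mono (by omega) hp)]
  exact hmin hx'

lemma linearBoundAttained_outerCone {p : Poly s n} (hp : p ∈ truncated (lowLetters s n ρ) r) :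
    LinearBoundAttained (outerCone (quadModule s n m r ρ)) p := by
  obtain ⟨y, hy, e⟩ := exists_mem_boundedOuter_eq_outBound hp
  exact ⟨y, hy.2, e⟩

/-- An element of the full outer cone is bounded below by a point evaluation. -/
lemma exists_evalSeq_re_le {p : Poly s n} (hp : ↑p.vars ⊆ lowLetters s n ρ) {y : MomentSeq s n}
    (hy : y ∈ normalized (outerCone (quadModuleTop s n m ρ))) :
    ∃ c ∈ ellipsoid s n m, (evalSeq p c).re ≤ (riesz y p).re := by
  classical
  -- Composition with this retraction makes `y` a state on the whole ring: for a letter of high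
  -- frequency, `1 - X_v X_v*` is mapped to `1`, so the archimedean condition holds for all letters.
  let π : Poly s n →ₐ[ℂ] Poly s n := aeval fun v => if v ∈ lowLetters s n ρ then X v else 0
  have hπ : ∀ q, ↑q.vars ⊆ lowLetters s n ρ → π q = q := by
    intro q hq
    exact hom_congr_vars (f₁ := (π : Poly s n →+* Poly s n)) (f₂ := RingHom.id _)
      (by ext; simp [π, algebraMap_eq]) (fun v hv _ => by simp [π, hq hv]) rfl
  have hvars : ∀ q, ↑(π q).vars ⊆ lowLetters s n ρ := by
    intro q
    rw [← mem_supported (R := ℂ)]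
    have : π.range ≤ supported ℂ (lowLetters s n ρ) := by
      rw [← Algebra.map_top, ← adjoin_range_X, AlgHom.map_adjoin, Algebra.adjoin_le_iff]
      rintro _ ⟨_, ⟨v, rfl⟩, rfl⟩
      simp only [π, aeval_X]
      split_ifs with hv
      · exact X_mem_supported.2 hv
      · exact zero_mem _
    exact this ⟨q, rfl⟩
  have hconj : ∀ q, π (conjRename conjLetter q) = conjRename conjLetter (π q) := by
    intro q
    induction q using MvPolynomial.induction_on with
    | C a => simp [π, algebraMap_eq]
    | add p q hp hq => simp only [map_add, hp, hq]
    | mul_X p v hp =>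
      have : conjLetter v ∈ lowLetters s n ρ ↔ v ∈ lowLetters s n ρ :=
        ⟨fun h => by simpa [conjLetter_involutive v] using conjLetter_mem_lowLetters h,
          conjLetter_mem_lowLetters⟩
      simp only [map_mul, hp, conjRename_X]
      congr 1
      by_cases hv : v ∈ lowLetters s n ρ <;> simp [π, this, hv]
  have hpos : ∀ r, ∀ g ∈ quadModule s n m r ρ, 0 ≤ functional y g := fun r g hg =>
    mem_outerCone_iff.1 hy.1 g (quadModule_subset_top hg)
  have htr : ∀ q, π q ∈ truncated (lowLetters s n ρ) (π q).totalDegree := fun q =>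
    mem_truncated.2 ⟨le_rfl, hvars q⟩
  let L : Poly s n →ₗ[ℂ] ℂ := functional y ∘ₗ π.toLinearMap
  let G : Set (Poly s n) := insert 1 (insert (ballPoly s n m ρ)
    (Set.range fun v : Letter s n => 1 - X v * X (conjLetter v)))
  have hsq : ∀ q, 0 ≤ functional y (conjRename conjLetter (π q) * π q) := fun q =>
    ((forall_quadModule_nonneg_iff _).1 (hpos _)).1 _ (htr q)
  have hstate : (fun α => L (monomial α 1)) ∈ states conjLetter G := by
    refine ⟨?_, fun q g hg => ?_⟩
    · have : (monomial 0 1 : Poly s n) = 1 := rfl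
      simp only [L, LinearMap.comp_apply, AlgHom.toLinearMap_apply, this, map_one]
      exact (functional_monomial y 0).trans hy.2
    · rw [functional_apply_monomial]
      simp only [L, LinearMap.comp_apply, AlgHom.toLinearMap_apply, map_mul, hconj]
      rcases hg with rfl | rfl | ⟨v, rfl⟩
      · simpa using hsq q
      · rw [hπ _ vars_ballPoly_subset]
        exact ((forall_quadModule_nonneg_iff _).1 (hpos _)).2 _ (Nat.lt_succ_self _) _ (htr q)
      · by_cases hv : v ∈ lowLetters s n ρ
        · have : π (1 - X v * X (conjLetter v)) = 1 - X v * X (conjLetter v) := by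
            simp [π, hv, conjLetter_mem_lowLetters hv]
          rw [this]
          exact apply_one_sub_X_mul_X_nonneg (hpos _) (Nat.lt_succ_self _) (htr q) hv
        · have : π (1 - X v * X (conjLetter v)) = 1 := by simp [π, hv]
          rw [this, mul_one]
          exact hsq q
  obtain ⟨z, hz, hG, hle⟩ := exists_eval_re_le_of_mem_states conjLetter_involutive
    (Set.mem_insert 1 _) (fun v => Or.inr (Or.inr ⟨v, rfl⟩)) hstate p
  rw [functional_apply_monomial] at hle
  obtain ⟨c, hc, hcz⟩ := exists_mem_ellipsoid
    (lowSeq_mem_seqEllipsoid hz (hG (ballPoly s n m ρ) (Or.inr (Or.inl rfl))))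
  refine ⟨c, hc, ?_⟩
  rw [hcz, evalSeq_congr hp fun v hv => letterValue_lowSeq hz hv, riesz_eq_functional]
  simpa only [L, LinearMap.comp_apply, AlgHom.toLinearMap_apply, hπ p hp] using hle

lemma outBoundTop_eq_optimum (hm : 0 < m) {p : Poly s n} (hp : ↑p.vars ⊆ lowLetters s n ρ) :
    outBoundTop m ρ p = optimum m p := by
  obtain ⟨c, hc, hmin⟩ := exists_isMinOn_evalSeq (s := s) (n := n) hm p
  rw [optimum_eq_of_isMinOn hc hmin]
  refine le_antisymm ?_ (le_iInf₂ fun y hy => ?_)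
  · refine (iInf₂_le _ (evalSeq_mem_outerCone ((mem_ellipsoid_iff c).1 hc))).trans_eq ?_
    rw [riesz_eq_functional, functional_evalSeq]
  · obtain ⟨c', hc', h⟩ := exists_evalSeq_re_le hp hy
    exact EReal.coe_le_coe_iff.2 ((hmin c' hc').trans h)

lemma outBound_mono (p : Poly s n) : Monotone fun r => outBound m r ρ p := fun _ _ h =>
  linearBound_anti (outerCone_anti (quadModule_mono h)) p

lemma outBound_le_outBoundTop (p : Poly s n) : outBound m r ρ p ≤ outBoundTop m ρ p :=
  linearBound_anti (outerCone_anti quadModule_subset_top) p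

lemma boundedOuter_anti {k : ℕ} (h : k ≤ r) : boundedOuter s n m r ρ ⊆ boundedOuter s n m k ρ :=
  fun _ hy => ⟨hy.1, outerCone_anti (quadModule_mono h) hy.2.1, hy.2.2⟩

/-- Cantor intersection: bounded solutions with value at most the supremum form nested nonempty
compact sets, and a common point satisfies the constraints of every order. -/
lemma tendsto_outBound (p : Poly s n) (hp : ↑p.vars ⊆ lowLetters s n ρ) :
    Tendsto (fun r => outBound m r ρ p) atTop (𝓝 (outBoundTop m ρ p)) := by
  have key : outBoundTop m ρ p = ⨆ r, outBound m r ρ p := by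
    refine le_antisymm ?_ (iSup_le fun r => outBound_le_outBoundTop p)
    set w := ⨆ r, outBound m r ρ p
    -- The shift by the degree of `p` ensures that each bound is attained, hence that each set is
    -- nonempty.
    let Z : ℕ → Set (MomentSeq s n) := fun k =>
      boundedOuter s n m (p.totalDegree + k) ρ ∩ {y | ((riesz y p).re : EReal) ≤ w}
    have hcl : IsClosed {y : MomentSeq s n | ((riesz y p).re : EReal) ≤ w} := by
      simp only [riesz_eq_functional]
      exact isClosed_le (continuous_coe_real_ereal.comp
        (Complex.continuous_re.comp (continuous_functional p))) continuous_const
    obtain ⟨y, hy⟩ := IsCompact.nonempty_iInter_of_sequence_nonempty_isCompact_isClosed Z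
      (fun k => Set.inter_subset_inter_left _ (boundedOuter_anti (by omega)))
      (fun k => by
        obtain ⟨y, hy, e⟩ := exists_mem_boundedOuter_eq_outBound (m := m)
          (mem_truncated.2 ⟨Nat.le_add_right p.totalDegree k, hp⟩)
        exact ⟨y, hy, e.trans_le (le_iSup (fun r => outBound m r ρ p) (p.totalDegree + k))⟩)
      (isCompact_boundedOuter.inter_right hcl)
      (fun k => isClosed_boundedOuter.inter hcl)
    rw [Set.mem_iInter] at hy
    refine (iInf₂_le y ⟨mem_outerCone_iff.2 fun g hg => ?_, (hy 0).1.2.2⟩).trans (hy 0).2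
    obtain ⟨r, hr⟩ := Set.mem_iUnion.1 hg
    exact mem_outerCone_iff.1 (hy r).1.2.1 g (quadModule_mono (Nat.le_add_left _ _) hr)
  rw [key]
  exact tendsto_atTop_iSup (outBound_mono p)

end OuterCone

/-! ### Generalized Rayleigh quotients -/

section QuadraticForms

/-- The quotient of two quadratic forms, the second one positive definite, attains its minimum. -/
lemma exists_eq_one_and_forall_mul_le {d : ℕ} (hd : 0 < d) {A N : (Fin d → ℂ) → ℝ}
    (hA : Continuous A) (hN : Continuous N) (hA2 : ∀ (t : ℝ) u, A ((t : ℂ) • u) = t ^ 2 * A u)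
    (hN2 : ∀ (t : ℝ) u, N ((t : ℂ) • u) = t ^ 2 * N u) (hpos : ∀ u ≠ 0, 0 < N u) :
    ∃ u, N u = 1 ∧ ∀ w, A u * N w ≤ A w := by
  have : Nonempty (Fin d) := ⟨⟨0, hd⟩⟩
  have hne : ∀ u ∈ Metric.sphere (0 : Fin d → ℂ) 1, u ≠ 0 := by
    rintro u hu rfl
    simp at hu
  -- The quotient is homogeneous of degree zero, so a minimum on the unit sphere is global; the
  -- minimizer is rescaled to `N u = 1` at the end.
  obtain ⟨u, hu, hmin⟩ := (isCompact_sphere (0 : Fin d → ℂ) 1).exists_isMinOn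
    ⟨fun _ => 1, by simp⟩ (hA.continuousOn.div hN.continuousOn fun u hu => (hpos u (hne u hu)).ne')
  have hNu := hpos u (hne u hu)
  have key : ∀ w, A u / N u * N w ≤ A w := by
    intro w
    by_cases hw : w = 0
    · have h1 := hA2 0 0
      have h2 := hN2 0 0
      simp only [smul_zero, ne_eq, OfNat.ofNat_ne_zero, not_false_eq_true, zero_pow, zero_mul]
        at h1 h2
      rw [hw, h1, h2, mul_zero]
    · have hw' : ‖w‖ ≠ 0 := norm_ne_zero_iff.2 hw
      have h := hmin (show ((‖w‖⁻¹ : ℝ) : ℂ) • w ∈ Metric.sphere (0 : Fin d → ℂ) 1 by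
        rw [mem_sphere_zero_iff_norm, norm_smul, Complex.norm_real, norm_inv, norm_norm,
          inv_mul_cancel₀ hw'])
      change A u / N u ≤ A _ / N _ at h
      rw [hA2, hN2, mul_div_mul_left _ _ (by positivity), le_div_iff₀ (hpos w hw)] at h
      exact h
  refine ⟨(((√(N u))⁻¹ : ℝ) : ℂ) • u, ?_, fun w => ?_⟩
  · rw [hN2, inv_pow, Real.sq_sqrt hNu.le, inv_mul_cancel₀ hNu.ne']
  · rw [hA2, inv_pow, Real.sq_sqrt hNu.le, inv_mul_eq_div]
    exact key w

variable {σ : Type*} {τ : σ → σ}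

lemma continuous_apply_conjRename_mul {d : ℕ} (L : MvPolynomial σ ℂ →ₗ[ℂ] ℂ)
    (q : (Fin d → ℂ) →ₗ[ℂ] MvPolynomial σ ℂ) (h : MvPolynomial σ ℂ) :
    Continuous fun u => (L (conjRename τ (q u) * q u * h)).re := by
  have e : ∀ u, L (conjRename τ (q u) * q u * h) = ∑ i, ∑ j, conj (u i) * u j *
      L (conjRename τ (q (Pi.single i 1)) * q (Pi.single j 1) * h) := by
    intro u
    conv_lhs => rw [q.pi_apply_eq_sum_univ u]
    have hs : ∀ i : Fin d, (fun j => if i = j then (1 : ℂ) else 0) = Pi.single i 1 := by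
      intro i; ext j; simp [Pi.single_apply, eq_comm]
    simp only [hs, map_sum, conjRename_smul, Finset.sum_mul, Finset.mul_sum, smul_mul_assoc,
      mul_smul_comm, map_smul, smul_eq_mul]
    rw [Finset.sum_comm]
    refine Finset.sum_congr rfl fun i _ => Finset.sum_congr rfl fun j _ => ?_
    ring
  simp only [e]
  fun_prop

lemma apply_conjRename_smul_mul (L : MvPolynomial σ ℂ →ₗ[ℂ] ℂ) (t : ℝ)
    (q h : MvPolynomial σ ℂ) :
    L (conjRename τ ((t : ℂ) • q) * ((t : ℂ) • q) * h) =
      ((t ^ 2 : ℝ) : ℂ) * L (conjRename τ q * q * h) := by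
  simp only [conjRename_smul, smul_mul_assoc, mul_smul_comm, map_smul, smul_eq_mul,
    Complex.conj_ofReal]
  push_cast
  ring

lemma finiteDimensional_truncated {W : Set σ} (hW : W.Finite) (r : ℕ) :
    FiniteDimensional ℂ (truncated W r) := by
  classical
  let S : Set (σ →₀ ℕ) := {α | α.degree ≤ r ∧ ↑α.support ⊆ W}
  have hS : S.Finite := by
    refine (hW.toFinset.finsupp fun _ => Finset.range (r + 1)).finite_toSet.subset ?_
    rintro α ⟨hα, hαW⟩
    rw [Finset.mem_coe, Finset.mem_finsupp_iff]
    refine ⟨fun v hv => hW.mem_toFinset.2 (hαW hv), fun v _ => ?_⟩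
    rw [Finset.mem_range]
    exact Nat.lt_succ_of_le ((Finsupp.le_degree v α).trans hα)
  have : Finite S := hS
  have : FiniteDimensional ℂ (restrictSupport ℂ S) :=
    Module.Finite.of_basis (basisRestrictSupport ℂ S)
  refine Submodule.finiteDimensional_of_le (S₂ := restrictSupport ℂ S) fun q hq => ?_
  rw [mem_restrictSupport_iff]
  exact fun α hα => degree_le_and_support_subset_of_mem_truncated hq hα

/-- The polynomials of total degree less than `r` in the indeterminates from `W`, as a subspace:
it is zero for `r = 0`. -/
def strictTruncated (W : Set σ) : ℕ → Submodule ℂ (MvPolynomial σ ℂ)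
  | 0 => ⊥
  | r + 1 => truncated W r

lemma mem_strictTruncated {W : Set σ} {r k : ℕ} (h : k < r) {q : MvPolynomial σ ℂ}
    (hq : q ∈ truncated W k) : q ∈ strictTruncated W r := by
  cases r with
  | zero => omega
  | succ r => exact truncated_mono (Nat.le_of_lt_succ h) hq

lemma strictTruncated_le (W : Set σ) (r : ℕ) : strictTruncated W r ≤ truncated W r := by
  cases r with
  | zero => exact bot_le
  | succ r => exact truncated_mono (Nat.le_succ r)

end QuadraticForms

/-! ### The inner bounds -/

section InnerCone

variable {s : Scalars} {n m r ρ : ℕ}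

lemma conjRename_mul_self_mem_quadModule {q : Poly s n}
    (hq : q ∈ truncated (lowLetters s n ρ) r) :
    conjRename conjLetter q * q ∈ quadModule s n m r ρ := by
  refine ⟨_, sq_mem_sumsOfSquares ?_, 0, zero_mem_sumsOfSquares _, by ring⟩
  rw [setOf_degree_le_eq]
  exact hq

lemma add_mul_ballPoly_mem_quadModule {q q' : Poly s n}
    (hq : q ∈ truncated (lowLetters s n ρ) r) (hq' : q' ∈ strictTruncated (lowLetters s n ρ) r) :
    conjRename conjLetter q * q + conjRename conjLetter q' * q' * ballPoly s n m ρ ∈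
      quadModule s n m r ρ := by
  have h1 : conjRename conjLetter q * q ∈
      sumsOfSquares {q : Poly s n | algebraicDegree q ≤ r ∧ harmonicDegree q ≤ ρ} := by
    refine sq_mem_sumsOfSquares ?_
    rw [setOf_degree_le_eq]
    exact hq
  refine ⟨_, h1, _, ?_, rfl⟩
  rw [setOf_degree_lt_eq]
  cases r with
  | zero =>
    have : q' = 0 := hq'
    rw [this, mul_zero]
    exact zero_mem_sumsOfSquares _
  | succ r => exact sq_mem_sumsOfSquares ⟨r, Nat.lt_succ_self r, hq'⟩

/-- A nonzero polynomial of low frequencies does not vanish identically in the interior of the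
ellipsoid. -/
lemma exists_evalSeq_ne_zero {q : Poly s n} (hq : ↑q.vars ⊆ lowLetters s n ρ) (h0 : q ≠ 0) :
    ∃ c ∈ ellipsoid s n m, evalSeq q c ≠ 0 ∧ evalSeq (ballPoly s n m ρ) c ≠ 0 := by
  set S := ∑ a ∈ lowFreqs n ρ, weight m a with hS
  have hS0 : 0 ≤ S := Finset.sum_nonneg fun a _ => weight_nonneg m a
  -- Small enough that coordinates of modulus at most `ε` lie strictly inside: `S ε² ≤ S ε < 1`.
  set ε : ℝ := (1 + S)⁻¹ with hε
  have hε0 : 0 < ε := by positivity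
  have hε1 : ε ≤ 1 := inv_le_one_of_one_le₀ (by linarith)
  have hεS : S * ε < 1 := by
    rw [hε, ← div_eq_mul_inv, div_lt_one (by positivity)]
    linarith
  have : ∃ z : Letter s n → ℂ, (∀ v, z (conjLetter v) = conj (z v)) ∧ (∀ v, ‖z v‖ ≤ ε) ∧
      eval z q ≠ 0 := by
    by_contra! hcon
    exact h0 (eq_zero_of_eval_eq_zero conjLetter_involutive hε0 hcon)
  obtain ⟨z, hz, hzε, hzq⟩ := this
  have hlow : ∀ v ∈ lowLetters s n ρ, letterValue (lowSeq ρ z) v = z v := fun v hv =>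
    letterValue_lowSeq hz hv
  have hb : evalSeq (ballPoly s n m ρ) (lowSeq ρ z) =
      ((1 - ∑ a ∈ lowFreqs n ρ, weight m a * ‖lowSeq ρ z a‖ ^ 2 : ℝ) : ℂ) :=
    evalSeq_ballPoly (isHermitianSeq_lowSeq hz)
  have hlt : ∑ a ∈ lowFreqs n ρ, weight m a * ‖lowSeq ρ z a‖ ^ 2 < 1 := by
    refine lt_of_le_of_lt ?_ hεS
    rw [hS, Finset.sum_mul]
    refine Finset.sum_le_sum fun a ha => mul_le_mul_of_nonneg_left ?_ (weight_nonneg m a)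
    have : ‖lowSeq ρ z a‖ ≤ ε := by
      simpa [lowSeq, ha] using hzε (coord s a)
    nlinarith [norm_nonneg (lowSeq ρ z a)]
  obtain ⟨c, hc, hcz⟩ := exists_mem_ellipsoid (lowSeq_mem_seqEllipsoid (m := m) (ρ := ρ) hz (by
    rw [← evalSeq_congr vars_ballPoly_subset hlow, hb, Complex.zero_le_real]
    linarith))
  refine ⟨c, hc, ?_, ?_⟩
  · rwa [hcz, evalSeq_congr hq hlow]
  · rw [hcz, hb, Complex.ofReal_ne_zero]
    linarith

lemma evalSeq_conjRename_mul_self_nonneg (q : Poly s n) {c : SeqSpace n}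
    (hc : c ∈ ellipsoid s n m) : 0 ≤ evalSeq (conjRename conjLetter q * q) c := by
  rw [evalSeq, map_mul, eval_conjRename ((mem_ellipsoid_iff c).1 hc).2, mul_comm, Complex.mul_conj]
  exact Complex.zero_le_real.2 (Complex.normSq_nonneg _)

lemma evalSeq_conjRename_mul_self_ne_zero {q : Poly s n} {c : SeqSpace n}
    (hc : c ∈ ellipsoid s n m) (hq : evalSeq q c ≠ 0) :
    evalSeq (conjRename conjLetter q * q) c ≠ 0 := by
  rw [evalSeq, map_mul, eval_conjRename ((mem_ellipsoid_iff c).1 hc).2]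
  exact mul_ne_zero ((map_ne_zero _).2 hq) hq

lemma evalSeq_ballPoly_nonneg {c : SeqSpace n} (hc : c ∈ ellipsoid s n m) :
    0 ≤ evalSeq (ballPoly s n m ρ) c := by
  rw [evalSeq_ballPoly ((mem_ellipsoid_iff c).1 hc).2, Complex.zero_le_real]
  linarith [((mem_ellipsoid_iff c).1 hc).1 (lowFreqs n ρ)]

lemma evalSeq_mul (g h : Poly s n) (c : Freq n → ℂ) :
    evalSeq (g * h) c = evalSeq g c * evalSeq h c := map_mul _ g h

lemma im_evalSeq_eq_zero {p : Poly s n} (hp : IsHermitian m p) {c : SeqSpace n}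
    (hc : c ∈ ellipsoid s n m) : (evalSeq p c).im = 0 := by
  obtain ⟨f, hf, rfl⟩ := hc
  rw [← evalFun_eq_evalSeq]
  exact hp f hf

variable [MeasurableSpace (SeqSpace n)] {γ : Measure (SeqSpace n)}

lemma innerCone_mono {Q Q' : Set (Poly s n)} (h : Q ⊆ Q') :
    innerCone m γ Q ⊆ innerCone m γ Q' := by
  rintro y ⟨g, hg, hy⟩
  exact ⟨g, h hg, hy⟩

lemma innBound_anti (p : Poly s n) : Antitone fun r => innBound m r ρ γ p := fun _ _ h =>
  linearBound_anti (innerCone_mono (quadModule_mono h)) p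

lemma innBoundTop_le_innBound (p : Poly s n) : innBoundTop m ρ γ p ≤ innBound m r ρ γ p :=
  linearBound_anti (innerCone_mono quadModule_subset_top) p

/-- Integration over the ellipsoid, as a functional on polynomials. -/
def moment (s : Scalars) (m : ℕ) (γ : Measure (SeqSpace n)) : Poly s n →ₗ[ℂ] ℂ :=
  functional fun α => ∫ c in ellipsoid s n m, evalSeq (monomial α 1 : Poly s n) c ∂γ

variable [BorelSpace (SeqSpace n)] [IsLocallyFiniteMeasure γ]

lemma integrableOn_evalSeq (hm : 0 < m) (g : Poly s n) :
    IntegrableOn (fun c : SeqSpace n => evalSeq g c) (ellipsoid s n m) γ :=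
  ((continuous_evalSeq g).comp continuous_coe_seqSpace).continuousOn.integrableOn_compact
    (isCompact_ellipsoid hm)

lemma moment_apply (hm : 0 < m) (g : Poly s n) :
    moment s m γ g = ∫ c in ellipsoid s n m, evalSeq g c ∂γ := by
  have e : ∀ c : SeqSpace n, evalSeq g c =
      ∑ α ∈ g.support, g.coeff α * evalSeq (monomial α 1 : Poly s n) c := fun c => by
    rw [← functional_apply (fun α => evalSeq (monomial α 1 : Poly s n) c), functional_evalSeq]
  rw [moment, functional_apply]
  simp only [e]
  rw [integral_finsetSum _ fun α _ => (integrableOn_evalSeq hm _).const_mul _]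
  simp only [integral_const_mul]

lemma moment_apply_eq_ofReal (hm : 0 < m) {g : Poly s n}
    (hg : ∀ c ∈ ellipsoid s n m, (evalSeq g c).im = 0) :
    moment s m γ g = ((∫ c in ellipsoid s n m, (evalSeq g c).re ∂γ : ℝ) : ℂ) := by
  rw [moment_apply hm, ← integral_complex_ofReal]
  refine setIntegral_congr_fun (isCompact_ellipsoid hm).isClosed.measurableSet fun c hc => ?_
  exact Complex.ext rfl (hg c hc)

lemma moment_nonneg (hm : 0 < m) {g : Poly s n} (hg : ∀ c ∈ ellipsoid s n m, 0 ≤ evalSeq g c) :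
    0 ≤ moment s m γ g := by
  rw [moment_apply_eq_ofReal hm fun c hc => (Complex.nonneg_iff.1 (hg c hc)).2.symm,
    Complex.zero_le_real]
  exact setIntegral_nonneg (isCompact_ellipsoid hm).isClosed.measurableSet fun c hc =>
    (Complex.nonneg_iff.1 (hg c hc)).1

/-- The integrand is continuous, so the set where it does not vanish is open; it meets the ellipsoid
and is therefore charged by `γ`. -/
lemma moment_re_pos (hm : 0 < m) (hγ : ∀ U : Set (SeqSpace n), IsOpen U →
      (U ∩ ellipsoid s n m).Nonempty → 0 < γ (U ∩ ellipsoid s n m)) {g : Poly s n}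
    (hg : ∀ c ∈ ellipsoid s n m, 0 ≤ evalSeq g c) {c : SeqSpace n} (hc : c ∈ ellipsoid s n m)
    (hgc : evalSeq g c ≠ 0) : 0 < (moment s m γ g).re := by
  have hE := (isCompact_ellipsoid (s := s) (n := n) hm).isClosed.measurableSet
  rw [moment_apply_eq_ofReal hm fun c hc => (Complex.nonneg_iff.1 (hg c hc)).2.symm,
    Complex.ofReal_re, setIntegral_pos_iff_support_of_nonneg_ae
      ((ae_restrict_iff' hE).2 (ae_of_all _ fun c hc => (Complex.nonneg_iff.1 (hg c hc)).1))
      (integrableOn_evalSeq hm g).re]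
  refine hγ _ (isOpen_ne_fun (Complex.continuous_re.comp
    ((continuous_evalSeq g).comp continuous_coe_seqSpace)) continuous_const) ⟨c, ?_, hc⟩
  intro h
  exact hgc (Complex.ext h (Complex.nonneg_iff.1 (hg c hc)).2.symm)

/-- The moments of a measure with a polynomial density. -/
lemma mem_normalized_innerCone_iff (hm : 0 < m) {Q : Set (Poly s n)} {y : MomentSeq s n} :
    y ∈ normalized (innerCone m γ Q) ↔
      ∃ g ∈ Q, moment s m γ g = 1 ∧ ∀ q, riesz y q = moment s m γ (q * g) := by
  have hmul : ∀ (g : Poly s n) (α : Letter s n →₀ ℕ), moment s m γ (monomial α 1 * g) =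
      ∫ c in ellipsoid s n m, evalSeq (monomial α 1 : Poly s n) c * evalSeq g c ∂γ := fun g α => by
    rw [moment_apply hm]
    simp only [evalSeq_mul]
  have h0 : (monomial 0 1 : Poly s n) = 1 := rfl
  constructor
  · rintro ⟨⟨g, hg, hy⟩, hy0⟩
    refine ⟨g, hg, ?_, fun q => ?_⟩
    · have h := hy 0
      rwa [← hmul, h0, one_mul, hy0, eq_comm] at h
    · have e : functional y = moment s m γ ∘ₗ LinearMap.mulRight ℂ g := functional_eq fun α => by
        rw [LinearMap.comp_apply, LinearMap.mulRight_apply, hmul]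
        exact hy α
      rw [riesz_eq_functional, e, LinearMap.comp_apply, LinearMap.mulRight_apply]
  · rintro ⟨g, hg, h1, hy⟩
    have hy' : ∀ α, y α = moment s m γ (monomial α 1 * g) := fun α => by
      rw [← hy, riesz_eq_functional, functional_monomial]
    refine ⟨⟨g, hg, fun α => (hy' α).trans (hmul g α)⟩, ?_⟩
    rw [hy', h0, one_mul, h1]

lemma exists_mem_normalized_innerCone (hm : 0 < m) {Q : Set (Poly s n)} {g : Poly s n}
    (hg : g ∈ Q) (h1 : moment s m γ g = 1) : ∃ y ∈ normalized (innerCone m γ Q),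
      ∀ q, riesz y q = moment s m γ (q * g) := by
  have h : ∀ q, riesz (fun α => (moment s m γ ∘ₗ LinearMap.mulRight ℂ g) (monomial α 1)) q =
      moment s m γ (q * g) := fun q => by
    rw [riesz_eq_functional, functional_apply_monomial, LinearMap.comp_apply,
      LinearMap.mulRight_apply]
  exact ⟨_, (mem_normalized_innerCone_iff hm).2 ⟨g, hg, h1, h⟩, h⟩

lemma im_moment_mul_and_im_moment_eq_zero (hm : 0 < m) {p : Poly s n} (hp : IsHermitian m p) {g : Poly s n}
    (hg : ∀ c ∈ ellipsoid s n m, 0 ≤ evalSeq g c) :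
    (moment s m γ (p * g)).im = 0 ∧ (moment s m γ g).im = 0 := by
  constructor
  · rw [moment_apply_eq_ofReal hm fun c hc => ?_, Complex.ofReal_im]
    rw [evalSeq_mul, Complex.mul_im, im_evalSeq_eq_zero hp hc,
      ← (Complex.nonneg_iff.1 (hg c hc)).2]
    ring
  · exact (Complex.nonneg_iff.1 (moment_nonneg hm hg)).2.symm

/-- The infimum over the truncated inner cone is attained. -/
lemma linearBoundAttained_innerCone (hm : 0 < m) (hγ : ∀ U : Set (SeqSpace n), IsOpen U →
      (U ∩ ellipsoid s n m).Nonempty → 0 < γ (U ∩ ellipsoid s n m)) {p : Poly s n}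
    (hp : IsHermitian m p) (r ρ : ℕ) :
    LinearBoundAttained (innerCone m γ (quadModule s n m r ρ)) p := by
  set M := moment s m γ with hM
  set b := ballPoly s n m ρ with hb
  have := finiteDimensional_truncated (finite_lowLetters (s := s) (n := n) (ρ := ρ)) r
  have := Submodule.finiteDimensional_of_le (strictTruncated_le (lowLetters s n ρ) r)
  -- It is enough to optimize over densities `q₀* q₀ + q₁* q₁ b` with one square in each summand:
  -- numerator `F p` and mass `F 1` are quadratic forms in the pair, and the minimizer is shown
  -- below to beat all sums of squares.
  let U := truncated (lowLetters s n ρ) r × strictTruncated (lowLetters s n ρ) r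
  let e := (Module.finBasis ℂ U).equivFun
  let q₀ : (Fin (Module.finrank ℂ U) → ℂ) →ₗ[ℂ] Poly s n :=
    Submodule.subtype _ ∘ₗ LinearMap.fst ℂ _ _ ∘ₗ e.symm.toLinearMap
  let q₁ : (Fin (Module.finrank ℂ U) → ℂ) →ₗ[ℂ] Poly s n :=
    Submodule.subtype _ ∘ₗ LinearMap.snd ℂ _ _ ∘ₗ e.symm.toLinearMap
  have hq₀ : ∀ u, q₀ u ∈ truncated (lowLetters s n ρ) r := fun u => (e.symm u).1.2
  have hq₁ : ∀ u, q₁ u ∈ strictTruncated (lowLetters s n ρ) r := fun u => (e.symm u).2.2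
  let F : Poly s n → (Fin (Module.finrank ℂ U) → ℂ) → ℝ := fun h u =>
    (M (conjRename conjLetter (q₀ u) * q₀ u * h)).re +
      (M (conjRename conjLetter (q₁ u) * q₁ u * (b * h))).re
  have hF : ∀ h, Continuous (F h) := fun h =>
    (continuous_apply_conjRename_mul M q₀ h).add (continuous_apply_conjRename_mul M q₁ (b * h))
  have hF2 : ∀ h (t : ℝ) u, F h ((t : ℂ) • u) = t ^ 2 * F h u := by
    intro h t u
    simp only [F, map_smul, apply_conjRename_smul_mul, Complex.re_ofReal_mul]
    ring
  have hsq0 : ∀ q : Poly s n, 0 ≤ (M (conjRename conjLetter q * q)).re := fun q =>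
    (Complex.nonneg_iff.1 (moment_nonneg hm fun c hc =>
      evalSeq_conjRename_mul_self_nonneg q hc)).1
  have hbnn : ∀ q : Poly s n, ∀ c ∈ ellipsoid s n m,
      0 ≤ evalSeq (conjRename conjLetter q * q * b) c := fun q c hc => by
    rw [evalSeq_mul]
    exact mul_nonneg (evalSeq_conjRename_mul_self_nonneg q hc) (evalSeq_ballPoly_nonneg hc)
  have hsq1 : ∀ q : Poly s n, 0 ≤ (M (conjRename conjLetter q * q * b)).re := fun q =>
    (Complex.nonneg_iff.1 (moment_nonneg hm (hbnn q))).1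
  have hpos : ∀ u ≠ 0, 0 < F 1 u := by
    intro u hu
    simp only [F, mul_one]
    by_cases h0 : q₀ u = 0
    · have h1 : q₁ u ≠ 0 := by
        intro h1
        refine hu ((LinearEquiv.map_eq_zero_iff e.symm).1 (Prod.ext ?_ ?_))
        · exact Subtype.ext h0
        · exact Subtype.ext h1
      obtain ⟨c, hc, hqc, hbc⟩ := exists_evalSeq_ne_zero (m := m)
        (mem_truncated.1 (strictTruncated_le _ _ (hq₁ u))).2 h1
      refine add_pos_of_nonneg_of_pos (hsq0 _) (moment_re_pos hm hγ (hbnn _) hc ?_)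
      rw [evalSeq_mul]
      exact mul_ne_zero (evalSeq_conjRename_mul_self_ne_zero hc hqc) hbc
    · obtain ⟨c, hc, hqc, -⟩ := exists_evalSeq_ne_zero (m := m) (mem_truncated.1 (hq₀ u)).2 h0
      exact add_pos_of_pos_of_nonneg (moment_re_pos hm hγ
        (fun c hc => evalSeq_conjRename_mul_self_nonneg _ hc) hc
        (evalSeq_conjRename_mul_self_ne_zero hc hqc)) (hsq1 _)
  have hd : 0 < Module.finrank ℂ U := by
    have : Nontrivial U := ⟨⟨(⟨1, one_mem_truncated _ _⟩, 0), 0, fun h =>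
      one_ne_zero (congrArg Subtype.val (congrArg Prod.fst h))⟩⟩
    exact Module.finrank_pos
  obtain ⟨u, hu1, hmin⟩ := exists_eq_one_and_forall_mul_le hd (hF p) (hF 1) (hF2 p) (hF2 1) hpos
  set g := conjRename conjLetter (q₀ u) * q₀ u + conjRename conjLetter (q₁ u) * q₁ u * b with hg
  have hgQ : g ∈ quadModule s n m r ρ := add_mul_ballPoly_mem_quadModule (hq₀ u) (hq₁ u)
  have hnn : ∀ g ∈ quadModule s n m r ρ, ∀ c ∈ ellipsoid s n m, 0 ≤ evalSeq g c :=
    fun g hg c hc => evalSeq_nonneg_of_mem_quadModule hg ((mem_ellipsoid_iff c).1 hc)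
  have hgF : ∀ h, (M (h * g)).re = F h u := fun h => by
    change _ = (M _).re + (M _).re
    rw [← Complex.add_re, ← map_add]
    congr 2
    rw [hg]
    ring
  have hFe : ∀ h x, F h (e x) = (M (conjRename conjLetter x.1.1 * x.1.1 * h)).re +
      (M (conjRename conjLetter x.2.1 * x.2.1 * (b * h))).re := by
    intro h x
    simp only [F, q₀, q₁, LinearMap.comp_apply, LinearEquiv.coe_coe, LinearEquiv.symm_apply_apply,
      LinearMap.fst_apply, LinearMap.snd_apply, Submodule.subtype_apply]
  have hM1 : M g = 1 := by
    refine Complex.ext ?_ (im_moment_mul_and_im_moment_eq_zero hm hp (hnn g hgQ)).2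
    rw [← one_mul g, hgF, hu1, Complex.one_re]
  obtain ⟨y, hy, hyM⟩ := exists_mem_normalized_innerCone (γ := γ) hm hgQ hM1
  refine ⟨y, hy, le_antisymm (le_iInf₂ fun x hx => ?_) (iInf₂_le y hy)⟩
  obtain ⟨g', hg', h1, hx'⟩ := (mem_normalized_innerCone_iff hm).1 hx
  rw [hyM, hx', EReal.coe_le_coe_iff, ← hM, hgF]
  -- Minimality of the eigenvalue `F p u` says that `L` is nonnegative on the generators (pairs with
  -- one zero entry), hence on the whole module. On a density of mass one this is the desired
  -- inequality.
  let L : Poly s n →ₗ[ℂ] ℂ := M ∘ₗ LinearMap.mulLeft ℂ p - (F p u : ℂ) • M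
  have hL : ∀ g, L g = M (p * g) - (F p u : ℂ) * M g := fun g => rfl
  have hLnn : ∀ g : Poly s n, (∀ c ∈ ellipsoid s n m, 0 ≤ evalSeq g c) →
      F p u * (M g).re ≤ (M (p * g)).re → 0 ≤ L g := by
    intro g hg hle
    obtain ⟨h1, h2⟩ := im_moment_mul_and_im_moment_eq_zero (γ := γ) hm hp hg
    rw [Complex.nonneg_iff, hL, Complex.sub_re, Complex.sub_im, Complex.re_ofReal_mul,
      Complex.im_ofReal_mul]
    refine ⟨by linarith, ?_⟩
    rw [h1, h2]
    ring
  have := (forall_quadModule_nonneg_iff L).2 ⟨fun q hq => ?_, fun k hk q hq => ?_⟩ g' hg'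
  · have h := (Complex.nonneg_iff.1 this).1
    rw [hL, show M g' = 1 from h1, Complex.sub_re, Complex.re_ofReal_mul, Complex.one_re] at h
    linarith
  · refine hLnn _ (fun c hc => evalSeq_conjRename_mul_self_nonneg q hc) ?_
    have h := hmin (e (⟨q, hq⟩, 0))
    rw [hFe, hFe] at h
    simp only [Submodule.coe_zero, mul_zero, zero_mul, map_zero, add_zero, mul_one,
      Complex.zero_re] at h
    rwa [mul_comm p]
  · refine hLnn _ (hbnn q) ?_
    have h := hmin (e (0, ⟨q, mem_strictTruncated hk hq⟩))
    rw [hFe, hFe] at h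
    simp only [Submodule.coe_zero, mul_zero, zero_mul, map_zero, zero_add, mul_one,
      Complex.zero_re] at h
    rwa [mul_comm p, mul_assoc _ b p]

/-- Both `p` minus its minimum and the density are nonnegative on the ellipsoid; integrate their
product. -/
lemma optimum_le_innBoundTop (hm : 0 < m) {p : Poly s n} (hp : IsHermitian m p) :
    optimum m p ≤ innBoundTop m ρ γ p := by
  obtain ⟨c, hc, hmin⟩ := exists_isMinOn_evalSeq (s := s) (n := n) hm p
  rw [optimum_eq_of_isMinOn hc hmin]
  refine le_iInf₂ fun y hy => ?_
  obtain ⟨g, hg, h1, hy'⟩ := (mem_normalized_innerCone_iff hm).1 hy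
  obtain ⟨r, hr⟩ := Set.mem_iUnion.1 hg
  rw [hy', EReal.coe_le_coe_iff]
  set t := (evalSeq p c).re
  have h : 0 ≤ moment s m γ ((p - C (t : ℂ)) * g) := moment_nonneg hm fun c' hc' => by
    rw [evalSeq_mul]
    refine mul_nonneg ?_ (evalSeq_nonneg_of_mem_quadModule hr ((mem_ellipsoid_iff _).1 hc'))
    have : evalSeq (p - C (t : ℂ)) c' = evalSeq p c' - (t : ℂ) := by simp [evalSeq]
    rw [this, Complex.nonneg_iff, Complex.sub_re, Complex.sub_im, im_evalSeq_eq_zero hp hc',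
      Complex.ofReal_re, Complex.ofReal_im, sub_zero]
    exact ⟨sub_nonneg.2 (hmin c' hc'), rfl⟩
  rw [sub_mul, map_sub, ← smul_eq_C_mul, map_smul, h1, smul_eq_mul, mul_one] at h
  simpa using (Complex.nonneg_iff.1 h).1

lemma innBound_le_div (hm : 0 < m) {p q : Poly s n} (hq : q ∈ truncated (lowLetters s n ρ) r)
    (hpos : 0 < (moment s m γ (conjRename conjLetter q * q)).re) :
    innBound m r ρ γ p ≤ (((moment s m γ (p * (conjRename conjLetter q * q))).re /
      (moment s m γ (conjRename conjLetter q * q)).re : ℝ) : EReal) := by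
  set N := (moment s m γ (conjRename conjLetter q * q)).re with hN
  have hNM : moment s m γ (conjRename conjLetter q * q) = (N : ℂ) :=
    Complex.ext rfl (Complex.nonneg_iff.1 (moment_nonneg hm fun c hc =>
      evalSeq_conjRename_mul_self_nonneg q hc)).2.symm
  set t : ℝ := (√N)⁻¹ with ht
  have ht2 : t ^ 2 = N⁻¹ := by rw [ht, inv_pow, Real.sq_sqrt hpos.le]
  have hs : ∀ h, moment s m γ (h * (conjRename conjLetter ((t : ℂ) • q) * ((t : ℂ) • q))) =
      ((N⁻¹ : ℝ) : ℂ) * moment s m γ (h * (conjRename conjLetter q * q)) := fun h => by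
    rw [mul_comm, apply_conjRename_smul_mul, ht2, mul_comm h]
  obtain ⟨y, hy, hyM⟩ := exists_mem_normalized_innerCone (γ := γ) hm
    (conjRename_mul_self_mem_quadModule (m := m)
      (Submodule.smul_mem _ (t : ℂ) hq)) (by
        rw [← one_mul (conjRename conjLetter ((t : ℂ) • q) * ((t : ℂ) • q)), hs, one_mul, hNM,
          ← Complex.ofReal_mul, inv_mul_cancel₀ hpos.ne', Complex.ofReal_one])
  refine (iInf₂_le y hy).trans_eq ?_
  rw [hyM, hs, Complex.re_ofReal_mul, inv_mul_eq_div]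

end InnerCone

/-! ### Concentration at a minimizer -/

section Peak

variable {s : Scalars} {n m ρ : ℕ}

/-- A polynomial that attains its maximum over the ellipsoid exactly where the coefficients of
frequency at most `ρ` agree with those of `c₀`. -/
def peakPoly (s : Scalars) (ρ : ℕ) (c₀ : Freq n → ℂ) : Poly s n :=
  C 4 - ∑ a ∈ lowFreqs n ρ, (X (coord s a) - C (c₀ a)) *
    (X (conjLetter (coord s a)) - C (conj (c₀ a)))

lemma conjRename_peakPoly (c₀ : Freq n → ℂ) :
    conjRename conjLetter (peakPoly s ρ c₀) = peakPoly s ρ c₀ := by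
  simp only [peakPoly, map_sub, map_sum, map_mul, conjRename_X, conjRename_C, Complex.conj_conj,
    conjLetter_involutive _, map_ofNat]
  simp only [mul_comm]

lemma peakPoly_mem_truncated (c₀ : Freq n → ℂ) :
    peakPoly s ρ c₀ ∈ truncated (lowLetters s n ρ) 2 := by
  have key : ∀ a ∈ lowFreqs n ρ, ((X (coord s a) - C (c₀ a)) *
      (X (conjLetter (coord s a)) - C (conj (c₀ a))) : Poly s n) ∈
        truncated (lowLetters s n ρ) (1 + 1) := fun a ha =>
    have h : coord s a ∈ lowLetters s n ρ := coord_mem_lowLetters.2 ha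
    mul_mem_truncated (sub_mem (X_mem_truncated h) (C_mem_truncated _ _ _))
      (sub_mem (X_mem_truncated (conjLetter_mem_lowLetters h)) (C_mem_truncated _ _ _))
  exact sub_mem (C_mem_truncated _ _ _) (sum_mem key)

lemma pow_mem_truncated {σ : Type*} {W : Set σ} {r : ℕ} {q : MvPolynomial σ ℂ}
    (hq : q ∈ truncated W r) (k : ℕ) : q ^ k ∈ truncated W (k * r) := by
  induction k with
  | zero => simpa using one_mem_truncated W 0
  | succ k ih =>
    rw [pow_succ, Nat.succ_mul]
    exact mul_mem_truncated ih hq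

lemma evalSeq_peakPoly (c₀ : Freq n → ℂ) {c : Freq n → ℂ} (hc : IsHermitianSeq s c) :
    evalSeq (peakPoly s ρ c₀) c =
      ((4 - ∑ a ∈ lowFreqs n ρ, ‖c a - c₀ a‖ ^ 2 : ℝ) : ℂ) := by
  rw [peakPoly, evalSeq]
  simp only [map_sub, map_sum, map_mul, eval_C, eval_X, hc _, letterValue_coord]
  simp only [← map_sub, Complex.mul_conj, Complex.normSq_eq_norm_sq]
  push_cast
  rfl

/-- Explains the constant `4` in `peakPoly`: the polynomial is nonnegative on the ellipsoid, so its
square peaks at the same points. -/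
lemma sum_norm_sub_sq_le {c c₀ : Freq n → ℂ} (hc : c ∈ seqEllipsoid s n m)
    (hc₀ : c₀ ∈ seqEllipsoid s n m) (F : Finset (Freq n)) :
    ∑ a ∈ F, ‖c a - c₀ a‖ ^ 2 ≤ 4 := by
  calc ∑ a ∈ F, ‖c a - c₀ a‖ ^ 2 ≤ ∑ a ∈ F, (2 * ‖c a‖ ^ 2 + 2 * ‖c₀ a‖ ^ 2) := by
        refine Finset.sum_le_sum fun a _ => ?_
        have := norm_sub_le (c a) (c₀ a)
        nlinarith [norm_nonneg (c a - c₀ a), sq_nonneg (‖c a‖ - ‖c₀ a‖)]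
    _ = 2 * ∑ a ∈ F, ‖c a‖ ^ 2 + 2 * ∑ a ∈ F, ‖c₀ a‖ ^ 2 := by
        rw [Finset.sum_add_distrib, Finset.mul_sum, Finset.mul_sum]
    _ ≤ 4 := by linarith [sum_norm_sq_le_one hc F, sum_norm_sq_le_one hc₀ F]

/-- The extension by zero of a family of Fourier coefficients of frequency at most `ρ`. -/
def extendLow {n ρ : ℕ} (x : lowFreqs n ρ → ℂ) : Freq n → ℂ := by
  classical exact fun a => if h : a ∈ lowFreqs n ρ then x ⟨a, h⟩ else 0

lemma continuous_extendLow : Continuous (extendLow : (lowFreqs n ρ → ℂ) → Freq n → ℂ) := by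
  classical
  refine continuous_pi fun a => ?_
  by_cases h : a ∈ lowFreqs n ρ
  · simpa [extendLow, h] using continuous_apply (⟨a, h⟩ : lowFreqs n ρ)
  · simpa [extendLow, h] using continuous_const

lemma evalSeq_extendLow {q : Poly s n} (hq : ↑q.vars ⊆ lowLetters s n ρ) (c : Freq n → ℂ) :
    evalSeq q (extendLow fun a : lowFreqs n ρ => c a) = evalSeq q c := by
  refine evalSeq_congr hq fun v hv => ?_
  rw [mem_lowLetters] at hv
  cases v <;> simp only [freq] at hv <;> simp [letterValue, extendLow, hv]

lemma evalSeq_peakPoly_im (c₀ : Freq n → ℂ) {c : SeqSpace n} (hc : c ∈ ellipsoid s n m) :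
    (evalSeq (peakPoly s ρ c₀) c).im = 0 := by
  rw [evalSeq_peakPoly _ ((mem_ellipsoid_iff c).1 hc).2, Complex.ofReal_im]

variable [MeasurableSpace (SeqSpace n)] [BorelSpace (SeqSpace n)] {γ : Measure (SeqSpace n)}
  [IsLocallyFiniteMeasure γ]

/-- The measures with density proportional to the powers of the squared peak polynomial concentrate
at the points that agree with `c₀` in low frequencies. -/
lemma tendsto_moment_peakPoly (hm : 0 < m) (hγ : ∀ U : Set (SeqSpace n), IsOpen U →
      (U ∩ ellipsoid s n m).Nonempty → 0 < γ (U ∩ ellipsoid s n m)) {p : Poly s n}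
    (hp : ↑p.vars ⊆ lowLetters s n ρ) {c₀ : SeqSpace n} (hc₀ : c₀ ∈ ellipsoid s n m) :
    Tendsto (fun k : ℕ => (∫ c in ellipsoid s n m,
        ((evalSeq (peakPoly s ρ c₀) c).re ^ 2) ^ k ∂γ)⁻¹ *
      ∫ c in ellipsoid s n m, ((evalSeq (peakPoly s ρ c₀) c).re ^ 2) ^ k * (evalSeq p c).re ∂γ)
      atTop (𝓝 (evalSeq p c₀).re) := by
  set E := ellipsoid s n m with hE
  have hEc : IsCompact E := isCompact_ellipsoid hm
  have : IsFiniteMeasure (γ.restrict E) := ⟨by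
    rw [Measure.restrict_apply_univ]
    exact hEc.measure_lt_top⟩
  -- The peak polynomial sees low frequencies only, so its maximizer on the ellipsoid need not be
  -- unique. Pushing `γ` forward to the finitely many low coordinates makes it unique, as Laplace's
  -- method requires.
  let P : SeqSpace n → lowFreqs n ρ → ℂ := fun c a => c a
  have hP : Continuous P := continuous_pi fun a =>
    (continuous_apply (a : Freq n)).comp continuous_coe_seqSpace
  have hs : IsCompact (P '' E) := hEc.image hP
  let μ := (γ.restrict E).map P
  let G : Poly s n → (lowFreqs n ρ → ℂ) → ℝ := fun q x => (evalSeq q (extendLow x)).re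
  have hG : ∀ q, Continuous (G q) := fun q =>
    Complex.continuous_re.comp ((continuous_evalSeq q).comp continuous_extendLow)
  have hGP : ∀ q : Poly s n, ↑q.vars ⊆ lowLetters s n ρ → ∀ c, G q (P c) = (evalSeq q c).re :=
    fun q hq c => congrArg Complex.re (evalSeq_extendLow hq c)
  have hpk : ↑(peakPoly s ρ c₀).vars ⊆ lowLetters s n ρ :=
    (mem_truncated.1 (peakPoly_mem_truncated (c₀ : Freq n → ℂ))).2
  have hval : ∀ c ∈ E, G (peakPoly s ρ c₀) (P c) =
      4 - ∑ a ∈ lowFreqs n ρ, ‖c a - c₀ a‖ ^ 2 := fun c hc => by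
    rw [hGP _ hpk, evalSeq_peakPoly _ ((mem_ellipsoid_iff c).1 hc).2, Complex.ofReal_re]
  have hval0 : ∀ c ∈ E, 0 ≤ G (peakPoly s ρ c₀) (P c) := fun c hc => by
    rw [hval c hc]
    linarith [sum_norm_sub_sq_le ((mem_ellipsoid_iff c).1 hc) ((mem_ellipsoid_iff c₀).1 hc₀)
      (lowFreqs n ρ)]
  have hval4 : G (peakPoly s ρ c₀) (P c₀) = 4 := by
    rw [hval c₀ hc₀]
    simp
  have hint : ∀ f : (lowFreqs n ρ → ℂ) → ℝ, Continuous f →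
      ∫ x in P '' E, f x ∂μ = ∫ c in E, f (P c) ∂γ := by
    intro f hf
    rw [setIntegral_map hs.isClosed.measurableSet hf.aestronglyMeasurable hP.aemeasurable,
      Measure.restrict_restrict (hP.measurable hs.isClosed.measurableSet),
      Set.inter_eq_self_of_subset_right (Set.subset_preimage_image P E)]
  have key := tendsto_setIntegral_pow_smul_of_unique_maximum_of_isCompact_of_measure_nhdsWithin_pos
    (μ := μ) (x₀ := P c₀) (c := fun x => G (peakPoly s ρ c₀) x ^ 2) (g := G p) hs
    (fun u hu hxu => by
      rw [Measure.map_apply hP.measurable (hu.measurableSet.inter hs.isClosed.measurableSet),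
        Measure.restrict_apply (hP.measurable (hu.measurableSet.inter hs.isClosed.measurableSet))]
      refine (hγ (P ⁻¹' u) (hu.preimage hP) ⟨c₀, hxu, hc₀⟩).trans_le (measure_mono ?_)
      exact fun c hc => ⟨⟨hc.1, Set.mem_image_of_mem P hc.2⟩, hc.2⟩)
    ((hG _).pow 2).continuousOn
    (by
      rintro _ ⟨c, hc, rfl⟩ hne
      refine pow_lt_pow_left₀ ?_ (hval0 c hc) two_ne_zero
      rw [hval4, hval c hc, sub_lt_self_iff]
      obtain ⟨a, ha⟩ := Function.ne_iff.1 hne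
      refine Finset.sum_pos' (fun _ _ => sq_nonneg _) ⟨a, a.2, ?_⟩
      have : ‖c a - c₀ a‖ ≠ 0 := norm_ne_zero_iff.2 (sub_ne_zero.2 ha)
      positivity)
    (fun _ _ => sq_nonneg _) (by rw [hval4]; norm_num) (Set.mem_image_of_mem P hc₀)
    ((hG p).continuousOn.integrableOn_compact hs) (hG p).continuousWithinAt
  rw [hGP p hp] at key
  refine key.congr fun k => ?_
  have h1 : Continuous fun x => (G (peakPoly s ρ c₀) x ^ 2) ^ k := ((hG _).pow 2).pow k
  have h2 : Continuous fun x => (G (peakPoly s ρ c₀) x ^ 2) ^ k * G p x := h1.mul (hG p)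
  simp only [smul_eq_mul]
  rw [hint _ h1, hint _ h2]
  simp only [hGP _ hpk, hGP _ hp]

/-- The peak polynomial `q` is Hermitian of degree at most two, so `(q²)^k` is the square of `q^k`
and, normalized, an admissible density of order `2k`. The averages of `p` against these densities
tend to its minimum. -/
lemma iInf_innBound_le_optimum (hm : 0 < m) (hγ : ∀ U : Set (SeqSpace n), IsOpen U →
      (U ∩ ellipsoid s n m).Nonempty → 0 < γ (U ∩ ellipsoid s n m)) {p : Poly s n}
    (hp : IsHermitian m p) (hpρ : ↑p.vars ⊆ lowLetters s n ρ) :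
    ⨅ r, innBound m r ρ γ p ≤ optimum m p := by
  obtain ⟨c₀, hc₀, hmin⟩ := exists_isMinOn_evalSeq (s := s) (n := n) hm p
  rw [optimum_eq_of_isMinOn hc₀ hmin]
  refine ge_of_tendsto' ((continuous_coe_real_ereal.tendsto _).comp
    (tendsto_moment_peakPoly hm hγ hpρ hc₀)) fun k => ?_
  set q := peakPoly s ρ (c₀ : Freq n → ℂ) with hq
  have hqk : conjRename conjLetter (q ^ k) * q ^ k = (q ^ 2) ^ k := by
    rw [map_pow, hq, conjRename_peakPoly, ← pow_mul, two_mul, pow_add]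
  have hev : ∀ c ∈ ellipsoid s n m, evalSeq (conjRename conjLetter (q ^ k) * q ^ k) c =
      ((((evalSeq q c).re ^ 2) ^ k : ℝ) : ℂ) := fun c hc => by
    have h : evalSeq q c = ((evalSeq q c).re : ℂ) :=
      Complex.ext rfl (evalSeq_peakPoly_im (c₀ : Freq n → ℂ) hc)
    have h2 : evalSeq ((q ^ 2) ^ k) c = (evalSeq q c ^ 2) ^ k := by simp [evalSeq]
    rw [hqk, h2, h]
    push_cast
    rfl
  have hEm := (isCompact_ellipsoid (s := s) (n := n) hm).isClosed.measurableSet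
  have h1 : (moment s m γ (conjRename conjLetter (q ^ k) * q ^ k)).re =
      ∫ c in ellipsoid s n m, ((evalSeq q c).re ^ 2) ^ k ∂γ := by
    rw [moment_apply_eq_ofReal hm fun c hc => by rw [hev c hc, Complex.ofReal_im],
      Complex.ofReal_re]
    exact setIntegral_congr_fun hEm fun c hc => by
      simp only [hev c hc, Complex.ofReal_re]
  have h2 : (moment s m γ (p * (conjRename conjLetter (q ^ k) * q ^ k))).re =
      ∫ c in ellipsoid s n m, ((evalSeq q c).re ^ 2) ^ k * (evalSeq p c).re ∂γ := by
    rw [moment_apply_eq_ofReal hm fun c hc => by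
      rw [evalSeq_mul, hev c hc, Complex.im_mul_ofReal, im_evalSeq_eq_zero hp hc, zero_mul],
      Complex.ofReal_re]
    exact setIntegral_congr_fun hEm fun c hc => by
      beta_reduce
      rw [evalSeq_mul, hev c hc, Complex.re_mul_ofReal, mul_comm]
  have hpos : 0 < (moment s m γ (conjRename conjLetter (q ^ k) * q ^ k)).re := by
    refine moment_re_pos hm hγ (fun c hc => evalSeq_conjRename_mul_self_nonneg _ hc) hc₀
      (evalSeq_conjRename_mul_self_ne_zero hc₀ ?_)
    have h3 : evalSeq (q ^ k) c₀ = evalSeq q c₀ ^ k := by simp [evalSeq]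
    rw [h3, hq, evalSeq_peakPoly _ ((mem_ellipsoid_iff c₀).1 hc₀).2]
    simp
  have := innBound_le_div (p := p) hm (pow_mem_truncated (peakPoly_mem_truncated _) k) hpos
  rw [h1, h2, div_eq_inv_mul] at this
  exact (iInf_le _ _).trans this

end Peak

end SobolevPOP

end

/-! ### Assembly of the theorem -/

theorem mainTheorem1 (s : SobolevPOP.Scalars) (n m : ℕ) (hn : 0 < n) (hm : 0 < m)
    [MeasurableSpace (SobolevPOP.SeqSpace n)] [BorelSpace (SobolevPOP.SeqSpace n)]
    (γ : Measure (SobolevPOP.SeqSpace n)) [IsLocallyFiniteMeasure γ]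
    (hγ : ∀ U : Set (SobolevPOP.SeqSpace n), IsOpen U →
      (U ∩ SobolevPOP.ellipsoid s n m).Nonempty → 0 < γ (U ∩ SobolevPOP.ellipsoid s n m))
    (p : SobolevPOP.Poly s n) (hp : SobolevPOP.IsHermitian m p)
    (ρ : ℕ) (hρ : ρ = SobolevPOP.harmonicDegree p) :
    -- the global optimum is attained
    (∃ f ∈ SobolevPOP.ball s n m,
      ((SobolevPOP.evalFun p f).re : EReal) = SobolevPOP.optimum m p) ∧
    -- so are the bounds of finite order
    (∀ r : ℕ, SobolevPOP.algebraicDegree p ≤ r →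
      SobolevPOP.LinearBoundAttained
        (SobolevPOP.outerCone (SobolevPOP.quadModule s n m r ρ)) p ∧
      SobolevPOP.LinearBoundAttained
        (SobolevPOP.innerCone m γ (SobolevPOP.quadModule s n m r ρ)) p) ∧
    -- monotonicity, and the values of infinite order
    (∀ r r' : ℕ, SobolevPOP.algebraicDegree p ≤ r' → r' ≤ r →
      SobolevPOP.outBound m r' ρ p ≤ SobolevPOP.outBound m r ρ p ∧
      SobolevPOP.outBound m r ρ p ≤ SobolevPOP.outBoundTop m ρ p ∧
      SobolevPOP.outBoundTop m ρ p = SobolevPOP.optimum m p ∧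
      SobolevPOP.optimum m p = SobolevPOP.innBoundTop m ρ γ p ∧
      SobolevPOP.innBoundTop m ρ γ p ≤ SobolevPOP.innBound m r ρ γ p ∧
      SobolevPOP.innBound m r ρ γ p ≤ SobolevPOP.innBound m r' ρ γ p) ∧
    -- convergence
    Tendsto (fun r : ℕ => SobolevPOP.outBound m r ρ p) atTop (𝓝 (SobolevPOP.optimum m p)) ∧
    Tendsto (fun r : ℕ => SobolevPOP.innBound m r ρ γ p) atTop (𝓝 (SobolevPOP.optimum m p)) := by
  have hpρ : ↑p.vars ⊆ SobolevPOP.lowLetters s n ρ := SobolevPOP.harmonicDegree_le_iff.1 hρ.ge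
  have hout := SobolevPOP.outBoundTop_eq_optimum hm hpρ
  have hle := SobolevPOP.optimum_le_innBoundTop (ρ := ρ) (γ := γ) hm hp
  have hInf := SobolevPOP.iInf_innBound_le_optimum (ρ := ρ) (γ := γ) hm hγ hp hpρ
  have hInf' : ⨅ r, SobolevPOP.innBound m r ρ γ p = SobolevPOP.optimum m p :=
    le_antisymm hInf (hle.trans (le_iInf fun _ => SobolevPOP.innBoundTop_le_innBound p))
  refine ⟨?_, fun r hr => ⟨?_, ?_⟩, fun r r' _ h => ⟨?_, ?_, hout, ?_, ?_, ?_⟩, ?_, ?_⟩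
  · obtain ⟨c, ⟨f, hf, rfl⟩, hmin⟩ := SobolevPOP.exists_isMinOn_evalSeq (s := s) (n := n) hm p
    refine ⟨f, hf, ?_⟩
    rw [SobolevPOP.optimum_eq_of_isMinOn ⟨f, hf, rfl⟩ hmin, SobolevPOP.evalFun_eq_evalSeq]
  · exact SobolevPOP.linearBoundAttained_outerCone (SobolevPOP.mem_truncated.2 ⟨hr, hpρ⟩)
  · exact SobolevPOP.linearBoundAttained_innerCone hm hγ hp r ρ
  · exact SobolevPOP.outBound_mono p h
  · exact SobolevPOP.outBound_le_outBoundTop p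
  · exact le_antisymm hle ((le_iInf fun _ => SobolevPOP.innBoundTop_le_innBound p).trans hInf)
  · exact SobolevPOP.innBoundTop_le_innBound p
  · exact SobolevPOP.innBound_anti p h
  · exact hout ▸ SobolevPOP.tendsto_outBound p hpρ
  · exact hInf' ▸ tendsto_atTop_iInf (SobolevPOP.innBound_anti p)
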